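/- For $(u,\eta)\in\mathbb R^2$ and $f\in L^2(\mathbb R)$ let $\pi(u,\eta)f(x)=e^{2\pi i\eta x}f(x-u)$. The Zak transform of $f\in L^2(\mathbb R)$ is defined on $[0,1]^2$ by $$Zf(x,\omega)=\sum_{k\in\mathbb Z}f(x+k)e^{-2\pi ik\omega},$$ with convergence in $L^2([0,1]^2)$, and it is extended to $\mathbb R^2$ by $Zf(x+m,\omega+n)=e^{2\pi im\omega}Zf(x,\omega)$ for $m,n\in\mathbb Z$. A cube is a square $Q=I_1\times I_2\subset\mathbb R^2$, where $I_1,I_2$ are closed intervals of the same positive length. For $F\in L^1_{\rm loc}(\mathbb R^2)$ put $F_Q=\frac1{|Q|}\int_QF$ and $M_Q(F)=\frac1{|Q|}\int_Q|F-F_Q|$. We write $F\in \mathrm{VMO}_{\rm loc}(\mathbb R^2)$ if for every bounded open set $U\subset\mathbb R^2$ we have $\sup\{M_Q(F): Q\subset U\text{ a cube}\}<\infty$ and $\lim_{\varepsilon\to0}\sup\{M_Q(F): Q\subset U\text{ a cube},\ |Q|<\varepsilon\}=0$. **Theorem 1.7.** Let $g\in L^2(\mathbb R)$ and let $\Lambda=A\mathbb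 Z^2$ with $A\in\mathrm{GL}(2,\mathbb Q)$ and $\det A=1$. If the Gabor system $\{\pi(b,a)g:(a,b)\in\Lambda\}=\{e^{2\pi iax}g(x-b):(a,b)\in\Lambda\}$ is a Riesz basis of $L^2(\mathbb R)$, then $Zg\notin \mathrm{VMO}_{\rm loc}(\mathbb R^2)$. -/

import Mathlib

open MeasureTheory Set Filter Topology

noncomputable section

/-! ### Time-frequency shifts and Gabor systems -/

theorem memLp_timeFreqShift (u η : ℝ) (f : Lp ℂ 2 (volume : Measure ℝ)) :
    MemLp (fun x : ℝ => Complex.exp (2 * Real.pi * Complex.I * η * x) * f (x - u)) 2 volume := by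
  have h1 : MemLp (fun x : ℝ => f (x - u)) 2 volume :=
    (Lp.memLp f).comp_measurePreserving (measurePreserving_sub_right volume u)
  refine h1.of_le ?_ (ae_of_all _ fun x => ?_)
  · exact (by fun_prop : Continuous fun x : ℝ =>
      Complex.exp (2 * Real.pi * Complex.I * η * x)).aestronglyMeasurable.mul h1.1
  · have : ‖Complex.exp (2 * Real.pi * Complex.I * η * x)‖ = 1 := by
      rw [show (2 * Real.pi * Complex.I * η * x : ℂ) = ((2 * Real.pi * η * x : ℝ) : ℂ) * Complex.I by
        push_cast; ring]
      exact Complex.norm_exp_ofReal_mul_I _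
    rw [norm_mul, this, one_mul]

/-- The time-frequency shift `π(u, η) f (x) = e^{2πiηx} f(x - u)` on `L²(ℝ)`. -/
def timeFreqShift (u η : ℝ) (f : Lp ℂ 2 (volume : Measure ℝ)) : Lp ℂ 2 (volume : Measure ℝ) :=
  (memLp_timeFreqShift u η f).toLp _

/-- The lattice `A ℤ²` in `ℝ²` for a rational matrix `A`. -/
def latticeOf (A : Matrix (Fin 2) (Fin 2) ℚ) : Set (Fin 2 → ℝ) :=
  Set.range fun k : Fin 2 → ℤ => (A.map fun q : ℚ => (q : ℝ)).mulVec fun i => (k i : ℝ)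

/-- The Gabor system `e^{2πiax} g(x - b)`, `(a, b) ∈ Λ`. -/
def gaborSystem (g : Lp ℂ 2 (volume : Measure ℝ)) (Λ : Set (Fin 2 → ℝ)) :
    Λ → Lp ℂ 2 (volume : Measure ℝ) :=
  fun p => timeFreqShift (p.1 1) (p.1 0) g

/-- A family `f` is a Riesz basis of the Hilbert space `H`: it is complete in `H` and satisfies
`α ∑ |cᵢ|² ≤ ‖∑ cᵢ fᵢ‖² ≤ β ∑ |cᵢ|²` for all finitely supported `c`, with constants
`α, β > 0`. -/
def IsRieszBasis {ι H : Type*} [NormedAddCommGroup H] [InnerProductSpace ℂ H] (f : ι → H) : Prop :=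
  (Submodule.span ℂ (Set.range f)).topologicalClosure = ⊤ ∧
    ∃ α β : ℝ, 0 < α ∧ 0 < β ∧ ∀ c : ι →₀ ℂ,
      α * (c.sum fun _ z => ‖z‖ ^ 2) ≤ ‖c.sum fun i z => z • f i‖ ^ 2 ∧
        ‖c.sum fun i z => z • f i‖ ^ 2 ≤ β * (c.sum fun _ z => ‖z‖ ^ 2)

/-! ### The Zak transform -/

/-- The unit square `[0,1]²`. -/
def unitSquare : Set (ℝ × ℝ) := Icc 0 1 ×ˢ Icc 0 1

theorem restrict_unitSquare : (volume : Measure (ℝ × ℝ)).restrict unitSquare =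
    ((volume : Measure ℝ).restrict (Icc 0 1)).prod ((volume : Measure ℝ).restrict (Icc 0 1)) := by
  rw [Measure.prod_restrict]; rfl

theorem norm_zakPhase (k : ℤ) (t : ℝ) :
    ‖Complex.exp (-(2 * Real.pi * Complex.I * k * t))‖ = 1 := by
  rw [show (-(2 * Real.pi * Complex.I * k * t) : ℂ) =
    ((-(2 * Real.pi * k * t) : ℝ) : ℂ) * Complex.I by push_cast; ring]
  exact Complex.norm_exp_ofReal_mul_I _

theorem memLp_zakTerm (f : Lp ℂ 2 (volume : Measure ℝ)) (k : ℤ) :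
    MemLp (fun p : ℝ × ℝ => f (p.1 + k) * Complex.exp (-(2 * Real.pi * Complex.I * k * p.2))) 2
      (volume.restrict unitSquare) := by
  rw [restrict_unitSquare]
  have h0 : MemLp (fun x : ℝ => f (x + k)) 2 (volume.restrict (Icc 0 1)) :=
    ((Lp.memLp f).comp_measurePreserving
      (measurePreserving_add_right volume (k : ℝ))).restrict _
  have h1 := h0.comp_fst ((volume : Measure ℝ).restrict (Icc 0 1))
  refine h1.of_le ?_ (ae_of_all _ fun p => ?_)
  · exact h1.1.mul (by fun_prop : Continuous fun p : ℝ × ℝ =>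
      Complex.exp (-(2 * Real.pi * Complex.I * k * p.2))).aestronglyMeasurable
  · rw [norm_mul, norm_zakPhase, mul_one]

/-- The `k`-th term `f(x + k) e^{-2πikω}` of the Zak series, as an element of `L²([0,1]²)`. -/
def zakTerm (f : Lp ℂ 2 (volume : Measure ℝ)) (k : ℤ) :
    Lp ℂ 2 ((volume : Measure (ℝ × ℝ)).restrict unitSquare) :=
  (memLp_zakTerm f k).toLp _

theorem coeFn_zakTerm (f : Lp ℂ 2 (volume : Measure ℝ)) (k : ℤ) :
    zakTerm f k =ᵐ[(volume : Measure (ℝ × ℝ)).restrict unitSquare]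
      fun p => f (p.1 + k) * Complex.exp (-(2 * Real.pi * Complex.I * k * p.2)) :=
  (memLp_zakTerm f k).coeFn_toLp

/-- The Zak transform of `f ∈ L²(ℝ)` on the unit square: the sum in `L²([0,1]²)` of the series
`∑ₖ f(x + k) e^{-2πikω}`. -/
def zakSquare (f : Lp ℂ 2 (volume : Measure ℝ)) :
    Lp ℂ 2 ((volume : Measure (ℝ × ℝ)).restrict unitSquare) :=
  ∑' k : ℤ, zakTerm f k

theorem inner_zakTerm (f : Lp ℂ 2 (volume : Measure ℝ)) (k l : ℤ) :
    inner ℂ (zakTerm f k) (zakTerm f l) =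
      (∫ x in Icc (0 : ℝ) 1, inner ℂ (f (x + k)) (f (x + l))) *
        ∫ t in Icc (0 : ℝ) 1, Complex.exp (2 * Real.pi * Complex.I * (k - l) * t) := by
  rw [L2.inner_def, ← integral_prod_mul, ← restrict_unitSquare]
  refine integral_congr_ae ?_
  filter_upwards [coeFn_zakTerm f k, coeFn_zakTerm f l] with p hk hl
  have e : (starRingEnd ℂ) (Complex.exp (-(2 * Real.pi * Complex.I * k * p.2))) =
      Complex.exp (2 * Real.pi * Complex.I * k * p.2) := by
    rw [← Complex.exp_conj]; simp [Complex.conj_ofNat]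
  have e2 : Complex.exp (2 * Real.pi * Complex.I * (k - l) * p.2) =
      Complex.exp (2 * Real.pi * Complex.I * k * p.2) *
        Complex.exp (-(2 * Real.pi * Complex.I * l * p.2)) := by
    rw [← Complex.exp_add]; ring_nf
  rw [hk, hl, e2]
  simp only [RCLike.inner_apply, map_mul, e]
  ring

theorem inner_zakTerm_of_ne (f : Lp ℂ 2 (volume : Measure ℝ)) {k l : ℤ} (h : k ≠ l) :
    inner ℂ (zakTerm f k) (zakTerm f l) = 0 := by
  rw [inner_zakTerm, integral_Icc_eq_integral_Ioc (x := (0 : ℝ)) (y := 1)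
    (f := fun t : ℝ => Complex.exp (2 * Real.pi * Complex.I * (k - l) * t)),
    ← intervalIntegral.integral_of_le zero_le_one, integral_exp_mul_complex]
  · have : Complex.exp (2 * Real.pi * Complex.I * (k - l)) = 1 := by
      rw [show (2 * Real.pi * Complex.I * (k - l) : ℂ) = ((k - l : ℤ) : ℂ) *
        (2 * Real.pi * Complex.I) by push_cast; ring]
      exact Complex.exp_int_mul_two_pi_mul_I _
    simp [this]
  · have : (k : ℂ) - l ≠ 0 := sub_ne_zero.2 (by exact_mod_cast h)
    exact mul_ne_zero Complex.two_pi_I_ne_zero this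

theorem norm_sq_zakTerm (f : Lp ℂ 2 (volume : Measure ℝ)) (k : ℤ) :
    ‖zakTerm f k‖ ^ 2 = ∫ x in (0 : ℝ)..1, ‖f (x + k)‖ ^ 2 := by
  have h := inner_zakTerm f k k
  rw [inner_self_eq_norm_sq_to_K] at h
  have h2 : ((‖zakTerm f k‖ ^ 2 : ℝ) : ℂ) = ((∫ x in (0 : ℝ)..1, ‖f (x + k)‖ ^ 2 : ℝ) : ℂ) := by
    rw [intervalIntegral.integral_of_le zero_le_one, ← integral_Icc_eq_integral_Ioc,
      ← integral_complex_ofReal]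
    simpa [inner_self_eq_norm_sq_to_K] using h
  exact_mod_cast h2

theorem hasSum_norm_sq_zakTerm (f : Lp ℂ 2 (volume : Measure ℝ)) :
    HasSum (fun k => ‖zakTerm f k‖ ^ 2) (‖f‖ ^ 2) := by
  have h : ‖f‖ ^ 2 = ∫ x, ‖f x‖ ^ 2 := by
    have := L2.inner_def (𝕜 := ℂ) f f
    rw [inner_self_eq_norm_sq_to_K] at this
    have h2 : ((‖f‖ ^ 2 : ℝ) : ℂ) = ((∫ x, ‖f x‖ ^ 2 : ℝ) : ℂ) := by
      rw [← integral_complex_ofReal]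
      simpa [inner_self_eq_norm_sq_to_K] using this
    exact_mod_cast h2
  simp_rw [norm_sq_zakTerm]
  rw [h]
  exact ((Lp.memLp f).integrable_norm_pow two_ne_zero).hasSum_intervalIntegral_comp_add_int

theorem orthogonalFamily_zakTerm (f : Lp ℂ 2 (volume : Measure ℝ)) :
    OrthogonalFamily ℂ (fun k : ℤ => Submodule.span ℂ {zakTerm f k})
      fun k => (Submodule.span ℂ {zakTerm f k}).subtypeₗᵢ := by
  rw [orthogonalFamily_iff_pairwise]
  intro k l h
  change Submodule.span ℂ _ ⟂ Submodule.span ℂ _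
  rw [Submodule.isOrtho_span]
  rintro u hu v hv
  rw [mem_singleton_iff.1 hu, mem_singleton_iff.1 hv]
  exact inner_zakTerm_of_ne f h

/-- The Zak series converges in `L²([0,1]²)` for every `f ∈ L²(ℝ)`. -/
theorem hasSum_zakSquare (f : Lp ℂ 2 (volume : Measure ℝ)) :
    HasSum (zakTerm f) (zakSquare f) := by
  have := (orthogonalFamily_zakTerm f).summable_iff_norm_sq_summable
    fun k => ⟨zakTerm f k, Submodule.mem_span_singleton_self _⟩
  exact (this.2 (hasSum_norm_sq_zakTerm f).summable).hasSum

/-- The map `f ↦ Zf|_{[0,1]²}` is isometric from `L²(ℝ)` to `L²([0,1]²)`. -/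
theorem norm_zakSquare (f : Lp ℂ 2 (volume : Measure ℝ)) : ‖zakSquare f‖ = ‖f‖ := by
  have h1 : Tendsto (fun s : Finset ℤ => ‖∑ k ∈ s, zakTerm f k‖ ^ 2) atTop
      (𝓝 (‖zakSquare f‖ ^ 2)) := ((hasSum_zakSquare f).norm).pow 2
  have h2 : ∀ s : Finset ℤ, ‖∑ k ∈ s, zakTerm f k‖ ^ 2 = ∑ k ∈ s, ‖zakTerm f k‖ ^ 2 := fun s =>
    (orthogonalFamily_zakTerm f).norm_sum
      (fun k => ⟨zakTerm f k, Submodule.mem_span_singleton_self _⟩) s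
  simp_rw [h2] at h1
  have := tendsto_nhds_unique h1 (hasSum_norm_sq_zakTerm f)
  exact (sq_eq_sq₀ (norm_nonneg _) (norm_nonneg _)).1 this

/-- For `f ∈ L¹(ℝ) ∩ L²(ℝ)`, `Zf` is almost everywhere the pointwise sum of the Zak series. -/
theorem zakSquare_ae_hasSum (f : Lp ℂ 2 (volume : Measure ℝ)) (hf : Integrable f volume) :
    ∀ᵐ p : ℝ × ℝ ∂(volume.restrict unitSquare),
      HasSum (fun k : ℤ => f (p.1 + k) * Complex.exp (-(2 * Real.pi * Complex.I * k * p.2)))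
        (zakSquare f p) := by
  have hsum : ∀ᵐ x : ℝ ∂(volume.restrict (Icc 0 1)), Summable fun k : ℤ => ‖f (x + k)‖ := by
    have hk : ∀ k : ℤ, Integrable (fun x : ℝ => f (x + k)) (volume.restrict (Icc 0 1)) :=
      fun k => (hf.comp_add_right (k : ℝ)).restrict
    have h1 : ∫⁻ x in Icc (0 : ℝ) 1, ∑' k : ℤ, ‖f (x + k)‖ₑ ≠ ⊤ := by
      rw [lintegral_tsum fun k => (hk k).1.enorm]
      simp_rw [← ofReal_integral_norm_eq_lintegral_enorm (hk _)]
      have := hf.norm.hasSum_intervalIntegral_comp_add_int.summable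
      simp_rw [intervalIntegral.integral_of_le zero_le_one, ← integral_Icc_eq_integral_Ioc] at this
      exact this.tsum_ofReal_ne_top
    have h2 := ae_lt_top' (AEMeasurable.tsum fun k : ℤ => (hk k).1.enorm) h1
    filter_upwards [h2] with x hx
    have := ENNReal.summable_toReal hx.ne
    simpa using this
  have hsum2 : ∀ᵐ p : ℝ × ℝ ∂(volume.restrict unitSquare),
      Summable fun k : ℤ => ‖f (p.1 + k)‖ := by
    rw [restrict_unitSquare]
    exact Measure.quasiMeasurePreserving_fst.ae hsum
  obtain ⟨s, hs, hlim⟩ :=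
    (tendstoInMeasure_of_tendsto_Lp (hasSum_zakSquare f)).exists_seq_tendsto_ae'
  have hterm := ae_all_iff.2 fun k => coeFn_zakTerm f k
  have hfin : ∀ᵐ p : ℝ × ℝ ∂(volume.restrict unitSquare), ∀ n : ℕ,
      (∑ k ∈ s n, zakTerm f k : Lp ℂ 2 _) p = ∑ k ∈ s n, zakTerm f k p :=
    ae_all_iff.2 fun n => by
      filter_upwards [Lp.coeFn_finsetSum (s n) (fun k => zakTerm f k)] with p hp
      simpa using hp
  filter_upwards [hsum2, hlim, hterm, hfin] with p h1 h2 h3 h4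
  have hS : Summable fun k : ℤ =>
      f (p.1 + k) * Complex.exp (-(2 * Real.pi * Complex.I * k * p.2)) := by
    refine Summable.of_norm ?_
    simpa only [norm_mul, norm_zakPhase, mul_one] using h1
  simp_rw [h4, h3] at h2
  rw [← tendsto_nhds_unique (hS.hasSum.comp hs) h2]
  exact hS.hasSum

/-- The Zak transform `Zf` on `ℝ²`: the quasi-periodic extension
`Zf(x + m, ω + n) = e^{2πimω} Zf(x, ω)`, `m, n ∈ ℤ`, of its values on the unit square. -/
def zak (f : Lp ℂ 2 (volume : Measure ℝ)) (p : ℝ × ℝ) : ℂ :=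
  Complex.exp (2 * Real.pi * Complex.I * ⌊p.1⌋ * p.2) * zakSquare f (Int.fract p.1, Int.fract p.2)

theorem zak_add_int (f : Lp ℂ 2 (volume : Measure ℝ)) (x w : ℝ) (m n : ℤ) :
    zak f (x + m, w + n) = Complex.exp (2 * Real.pi * Complex.I * m * w) * zak f (x, w) := by
  have e : Complex.exp (2 * Real.pi * Complex.I * (⌊x⌋ + m) * (w + n)) =
      Complex.exp (2 * Real.pi * Complex.I * m * w) *
        Complex.exp (2 * Real.pi * Complex.I * ⌊x⌋ * w) := by
    rw [← Complex.exp_add, Complex.exp_eq_exp_iff_exists_int]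
    exact ⟨(⌊x⌋ + m) * n, by push_cast; ring⟩
  simp only [zak, Int.floor_add_intCast, Int.fract_add_intCast]
  push_cast
  rw [e, mul_assoc]

theorem locallyIntegrable_zak (f : Lp ℂ 2 (volume : Measure ℝ)) :
    LocallyIntegrable (zak f) volume := by
  have h0 : IntegrableOn (zakSquare f) unitSquare volume := by
    have : IsFiniteMeasure ((volume : Measure (ℝ × ℝ)).restrict unitSquare) := by
      rw [restrict_unitSquare]; infer_instance
    exact (Lp.memLp (zakSquare f)).integrable (by norm_num)
  have hm : Measurable (zak f) := by
    unfold zak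
    have := (Lp.stronglyMeasurable (zakSquare f)).measurable
    fun_prop
  have h1 : ∀ m n : ℤ, IntegrableOn (zak f) (Ico (m : ℝ) (m + 1) ×ˢ Ico (n : ℝ) (n + 1)) := by
    intro m n
    have hsub : (Ico 0 1 ×ˢ Ico 0 1 : Set (ℝ × ℝ)) ⊆ unitSquare :=
      Set.prod_mono Ico_subset_Icc_self Ico_subset_Icc_self
    have hpre : (fun p : ℝ × ℝ => p + (-(m : ℝ), -(n : ℝ))) ⁻¹' (Ico 0 1 ×ˢ Ico 0 1) =
        Ico (m : ℝ) (m + 1) ×ˢ Ico (n : ℝ) (n + 1) := by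
      ext p
      simp only [mem_preimage, mem_prod, mem_Ico, Prod.fst_add, Prod.snd_add]
      constructor <;> rintro ⟨⟨_, _⟩, _, _⟩ <;> refine ⟨⟨?_, ?_⟩, ?_, ?_⟩ <;> linarith
    have h2 := ((measurePreserving_add_right (volume : Measure (ℝ × ℝ))
      (-(m : ℝ), -(n : ℝ))).integrableOn_comp_preimage
        (MeasurableEquiv.addRight (-(m : ℝ), -(n : ℝ))).measurableEmbedding).2
          (h0.mono_set hsub)
    rw [hpre] at h2
    refine Integrable.mono h2 hm.aestronglyMeasurable ?_
    filter_upwards [ae_restrict_mem (measurableSet_Ico.prod measurableSet_Ico)] with p hp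
    have hx : ⌊p.1⌋ = m := Int.floor_eq_iff.2 hp.1
    have hy : ⌊p.2⌋ = n := Int.floor_eq_iff.2 hp.2
    have he : ‖Complex.exp (2 * Real.pi * Complex.I * ⌊p.1⌋ * p.2)‖ = 1 := by
      simpa using norm_zakPhase (-⌊p.1⌋) p.2
    rw [zak, norm_mul, he, one_mul, Int.fract, Int.fract, hx, hy]
    simp only [sub_eq_add_neg, Function.comp]
    exact le_of_eq rfl
  rw [locallyIntegrable_iff]
  intro K hK
  obtain ⟨R, hR⟩ := hK.isBounded.subset_closedBall 0
  obtain ⟨N, hN⟩ := exists_nat_gt R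
  have : K ⊆ ⋃ i ∈ (Finset.Icc (-N : ℤ) N ×ˢ Finset.Icc (-N : ℤ) N),
      Ico (i.1 : ℝ) (i.1 + 1) ×ˢ Ico (i.2 : ℝ) (i.2 + 1) := by
    intro p hp
    have hb := hR hp
    rw [mem_closedBall_zero_iff, Prod.norm_def, sup_le_iff, Real.norm_eq_abs, Real.norm_eq_abs,
      abs_le, abs_le] at hb
    have hl : ∀ y : ℝ, -R ≤ y → y ≤ R → ⌊y⌋ ∈ Finset.Icc (-N : ℤ) N := fun y h1 h2 => by
      rw [Finset.mem_Icc, Int.le_floor]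
      refine ⟨by push_cast; linarith, ?_⟩
      exact_mod_cast (Int.floor_le y).trans (h2.trans hN.le)
    simp only [mem_iUnion]
    exact ⟨(⌊p.1⌋, ⌊p.2⌋), Finset.mem_product.2 ⟨hl _ hb.1.1 hb.1.2, hl _ hb.2.1 hb.2.2⟩,
      ⟨Int.floor_le _, Int.lt_floor_add_one _⟩, Int.floor_le _, Int.lt_floor_add_one _⟩
  exact (integrableOn_finset_iUnion.2 fun i _ => h1 i.1 i.2).mono_set this

/-! ### Vanishing mean oscillation -/

/-- The cube `[c₁, c₁ + δ] × [c₂, c₂ + δ]` in `ℝ²`. -/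
def cube (c : ℝ × ℝ) (δ : ℝ) : Set (ℝ × ℝ) :=
  Icc c.1 (c.1 + δ) ×ˢ Icc c.2 (c.2 + δ)

/-- The mean oscillation `M_Δ(F)`: the average over `Δ` of `|F - F_Δ|`, where `F_Δ` is the average
of `F` over `Δ`. -/
def meanOsc (F : ℝ × ℝ → ℂ) (Δ : Set (ℝ × ℝ)) : ℝ :=
  ⨍ p in Δ, ‖F p - ⨍ q in Δ, F q‖

/-- `S_{ε,U}(F)`: the supremum (in `[0, ∞]`) of `M_Q(F)` over the cubes `Q ⊆ U` of area less than
`ε`. -/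
def oscSup (ε : ℝ) (U : Set (ℝ × ℝ)) (F : ℝ × ℝ → ℂ) : ENNReal :=
  ⨆ (c : ℝ × ℝ) (δ : ℝ) (_ : 0 < δ) (_ : cube c δ ⊆ U)
    (_ : volume (cube c δ) < ENNReal.ofReal ε), ENNReal.ofReal (meanOsc F (cube c δ))

/-- Bounded mean oscillation on `U`: `F ∈ L¹_loc(ℝ²)` and `sup_{Q ⊆ U} M_Q(F) < ∞`. -/
def IsBMO (F : ℝ × ℝ → ℂ) (U : Set (ℝ × ℝ)) : Prop :=
  LocallyIntegrable F volume ∧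
    ∃ C : ℝ, ∀ (c : ℝ × ℝ) (δ : ℝ), 0 < δ → cube c δ ⊆ U → meanOsc F (cube c δ) ≤ C

/-- Vanishing mean oscillation on `U`: `F ∈ BMO(U)` and `S_{ε,U}(F) → 0` as `ε → 0`. -/
def IsVMO (F : ℝ × ℝ → ℂ) (U : Set (ℝ × ℝ)) : Prop :=
  IsBMO F U ∧ Tendsto (fun ε : ℝ => oscSup ε U F) (𝓝[>] 0) (𝓝 0)

/-- `F ∈ VMO_loc(ℝ²)`: `F ∈ VMO(U)` for every bounded open `U ⊆ ℝ²`. -/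
def IsVMOLoc (F : ℝ × ℝ → ℂ) : Prop :=
  ∀ U : Set (ℝ × ℝ), IsOpen U → Bornology.IsBounded U → IsVMO F U

end

/-!
The proof is by contradiction and compares two facts about one determinant.

*The determinant.* Write `Λ = Aℤ²` and choose `N ≥ 1` with `NA` integral. Then `Nℤ² ⊆ Λ` has index
`N²`, because `det A = 1` (`exists_cosets_latticeOf`); let `λⱼ` represent the cosets. The Zak
transform turns `π(λⱼ + N(k, -l)) g` into `e^{2πiN(kx + lω)} Fⱼ`, where
`Fⱼ(x, ω) = e^{2πiaⱼx} Zg(x - bⱼ, ω - aⱼ)` for `λⱼ = (aⱼ, bⱼ)` (`zak_timeFreqShift`,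
`gaborZak_add_mul`). The characters have period `1/N`, so the `N²` functions `Fⱼ` have to be
compared at the `N²` points `z + (r/N, s/N)`, which gives a square matrix (`zakMatrix`).

*It is bounded away from zero.* The Riesz inequalities, tested on `∑ vⱼ pₖ qₗ π(λⱼ + N(k, -l)) g`
for trigonometric polynomials `p` and `q` approximating indicators of intervals, localize by
Lebesgue differentiation to `α|v|² ≤ |M(z)v|² ≤ β|v|²` for almost every `z` (`ae_bounds_cellSum`).
The upper bound makes `Zg` bounded, the lower bound keeps `det M` away from `0`
(`le_norm_det_of_bounded_below`); `M` is square because `Λ` and `ℤ²` have the same covolume.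

*It cannot be.* Each row of `M` inherits `M(x + 1, ω) = e^{2πiω} M(x, ω)` up to a constant phase, so
`det M` gains the factor `e^{2πi(N²ω + θ)}` under `x ↦ x + 1` and is `1`-periodic in `ω`. If `Zg`
were in `VMO_loc`, then `det M` would be a bounded function of vanishing mean oscillation, these
forming an algebra (`IsBddVMO.mul`, `IsBddVMO.det`). Its averages over small squares would be continuous and
nowhere zero, with nearly the same quasi-periodicity; comparing winding numbers in `ω` at `x = 0`
and `x = 1` yields `N² = 0` (`IsBddVMO.eq_zero_of_quasiperiodic`).
-/

/-! ### Characters and winding numbers -/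

/-- The character `t ↦ e^{2πit}` of `ℝ`. -/
noncomputable def unitExp (t : ℝ) : ℂ := Complex.exp (2 * Real.pi * Complex.I * t)

theorem unitExp_add (s t : ℝ) : unitExp (s + t) = unitExp s * unitExp t := by
  rw [unitExp, unitExp, unitExp, ← Complex.exp_add]
  push_cast
  ring_nf

theorem norm_unitExp (t : ℝ) : ‖unitExp t‖ = 1 := by
  rw [unitExp, show (2 * Real.pi * Complex.I * t : ℂ) = ((2 * Real.pi * t : ℝ) : ℂ) * Complex.I by
    push_cast; ring]
  exact Complex.norm_exp_ofReal_mul_I _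

theorem unitExp_ne_zero (t : ℝ) : unitExp t ≠ 0 := Complex.exp_ne_zero _

theorem unitExp_int (n : ℤ) : unitExp n = 1 := by
  rw [unitExp, show (2 * Real.pi * Complex.I * (n : ℝ) : ℂ) = n * (2 * Real.pi * Complex.I) by
    push_cast; ring]
  exact Complex.exp_int_mul_two_pi_mul_I n

theorem unitExp_add_int (t : ℝ) (n : ℤ) : unitExp (t + n) = unitExp t := by
  rw [unitExp_add, unitExp_int, mul_one]

@[fun_prop]
theorem continuous_unitExp : Continuous unitExp := by
  unfold unitExp
  fun_prop

@[fun_prop]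
theorem measurable_unitExp : Measurable unitExp := continuous_unitExp.measurable

theorem unitExp_sum {ι : Type*} (s : Finset ι) (t : ι → ℝ) :
    unitExp (∑ i ∈ s, t i) = ∏ i ∈ s, unitExp (t i) := by
  classical
  induction s using Finset.induction_on with
  | empty => simpa using unitExp_int 0
  | insert a s ha ih => rw [Finset.sum_insert ha, Finset.prod_insert ha, unitExp_add, ih]

theorem norm_unitExp_sub_le (s t : ℝ) : ‖unitExp s - unitExp t‖ ≤ 2 * Real.pi * |s - t| := by
  have h : unitExp s - unitExp t = unitExp t * (unitExp (s - t) - 1) := by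
    rw [mul_sub, ← unitExp_add, mul_one]
    congr 2
    ring
  rw [h, norm_mul, norm_unitExp, one_mul, unitExp]
  have := Real.norm_exp_I_mul_ofReal_sub_one_le (x := 2 * Real.pi * (s - t))
  rw [Real.norm_eq_abs, abs_mul, abs_of_pos Real.two_pi_pos] at this
  convert this using 4
  push_cast
  ring

/-- By uniqueness of lifts through the covering `exp`. -/
theorem eq_of_exp_eq_one {X : Type*} [TopologicalSpace X] [PreconnectedSpace X] {φ : X → ℂ}
    (hφ : Continuous φ) (h : ∀ x, Complex.exp (φ x) = 1) (x y : X) : φ x = φ y := by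
  have := Complex.isCoveringMap_exp.eq_of_comp_eq (g₁ := φ) (g₂ := fun _ => φ y) hφ
    continuous_const (by ext z; simp [h]) y rfl
  exact congrFun this x

/-- A nowhere vanishing continuous function on the plane that is `1`-periodic in the second variable
has the same winding number along `{0} × [0, 1]` and `{1} × [0, 1]`; hence its two restrictions
cannot differ, up to a relative error less than `1`, by a factor `e^{2πi(nω + θ)}` with `n ≠ 0`. -/
theorem winding_eq_zero {H : ℝ × ℝ → ℂ} (hc : Continuous H) (h0 : ∀ z, H z ≠ 0)
    (hper : ∀ x w, H (x, w + 1) = H (x, w)) (n : ℤ) (θ : ℝ)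
    (hq : ∀ w, ‖H (1, w) - unitExp (n * w + θ) * H (0, w)‖ < ‖H (0, w)‖) : n = 0 := by
  have hsc : IsSimplyConnected (univ : Set (ℝ × ℝ)) := by
    have := (convex_univ (𝕜 := ℝ) (E := ℝ × ℝ)).contractibleSpace univ_nonempty
    exact SimplyConnectedSpace.ofContractible _
  obtain ⟨f, hf, hfH⟩ := Complex.exists_continuousOn_eqOn_exp_comp (X := ℝ × ℝ) (U := univ)
    (g := H) hsc isOpen_univ hc.continuousOn
    (by rintro ⟨z, -, hz⟩; exact h0 z hz)
  rw [continuousOn_univ] at hf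
  replace hfH : ∀ z, Complex.exp (f z) = H z := fun z => hfH (mem_univ z)
  have hden : ∀ w, unitExp (n * w + θ) * H (0, w) ≠ 0 :=
    fun w => mul_ne_zero (unitExp_ne_zero _) (h0 _)
  set R : ℝ → ℂ := fun w => H (1, w) / (unitExp (n * w + θ) * H (0, w)) with hR
  have hRc : Continuous R := by
    refine Continuous.div ?_ ?_ hden <;> fun_prop
  have hRs : ∀ w, R w ∈ Complex.slitPlane := fun w => by
    have : ‖R w - 1‖ < 1 := by
      rw [hR]
      simp only
      rw [div_sub_one (hden w), norm_div, norm_mul, norm_unitExp, one_mul,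
        div_lt_one (norm_pos_iff.2 (h0 _))]
      exact hq w
    simpa using Complex.mem_slitPlane_of_norm_lt_one this
  have hR1 : R 1 = R 0 := by
    have e1 := hper 1 0
    have e2 := hper 0 0
    rw [zero_add] at e1 e2
    simp only [hR]
    rw [e1, e2, show (n : ℝ) * 1 + θ = (n * 0 + θ) + n by ring, unitExp_add_int]
  have hk := eq_of_exp_eq_one (φ := fun x => f (x, 1) - f (x, 0)) (by fun_prop) (fun x => by
    have e1 := hper x 0
    rw [zero_add] at e1
    rw [Complex.exp_sub, hfH, hfH, e1, div_self (h0 _)]) 1 0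
  have hl := eq_of_exp_eq_one
    (φ := fun w : ℝ => f (1, w) - f (0, w) - 2 * Real.pi * Complex.I * (n * w + θ : ℝ)
      - Complex.log (R w))
    (by
      have : Continuous fun w => Complex.log (R w) := hRc.clog hRs
      fun_prop) (fun w => by
    rw [Complex.exp_sub, Complex.exp_sub, Complex.exp_sub, hfH, hfH,
      Complex.exp_log (Complex.slitPlane_ne_zero (hRs w)), ← unitExp, hR]
    have := h0 (0, w)
    have := h0 (1, w)
    have := unitExp_ne_zero (n * w + θ)
    field_simp) 1 0
  simp only [hR1] at hl hk
  have h2 : (2 * Real.pi * Complex.I) * (n : ℂ) = 0 := by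
    push_cast at hl
    linear_combination hk - hl
  simpa [Real.pi_ne_zero] using h2

/-! ### Bounded functions of vanishing mean oscillation -/

theorem measurableSet_cube (c : ℝ × ℝ) (δ : ℝ) : MeasurableSet (cube c δ) :=
  measurableSet_Icc.prod measurableSet_Icc

theorem volume_cube (c : ℝ × ℝ) {δ : ℝ} (hδ : 0 < δ) :
    volume (cube c δ) = ENNReal.ofReal (δ ^ 2) := by
  rw [cube, Measure.volume_eq_prod, Measure.prod_prod, Real.volume_Icc, Real.volume_Icc,
    ← ENNReal.ofReal_mul (by linarith)]
  congr 1
  ring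

theorem volume_real_cube (c : ℝ × ℝ) {δ : ℝ} (hδ : 0 < δ) : volume.real (cube c δ) = δ ^ 2 := by
  rw [Measure.real, volume_cube c hδ, ENNReal.toReal_ofReal (by positivity)]

theorem volume_cube_lt_top (c : ℝ × ℝ) {δ : ℝ} (hδ : 0 < δ) : volume (cube c δ) < ⊤ := by
  rw [volume_cube c hδ]; exact ENNReal.ofReal_lt_top

theorem cube_subset_closedBall (c : ℝ × ℝ) (δ : ℝ) : cube c δ ⊆ Metric.closedBall c δ := by
  rintro z ⟨⟨h1, h2⟩, h3, h4⟩
  rw [Metric.mem_closedBall, Prod.dist_eq, Real.dist_eq, Real.dist_eq]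
  exact max_le (abs_le.2 ⟨by linarith, by linarith⟩) (abs_le.2 ⟨by linarith, by linarith⟩)

theorem setIntegral_cube_add {E : Type*} [NormedAddCommGroup E] [NormedSpace ℝ E]
    (F : ℝ × ℝ → E) (c s : ℝ × ℝ) (δ : ℝ) :
    ∫ z in cube c δ, F (z + s) = ∫ z in cube (c + s) δ, F z := by
  have := (measurePreserving_add_right (volume : Measure (ℝ × ℝ)) s).setIntegral_preimage_emb
    (MeasurableEquiv.addRight s).measurableEmbedding F (cube (c + s) δ)
  rw [← this]
  congr 2
  ext z
  simp only [cube, mem_prod, mem_Icc, mem_preimage, Prod.fst_add, Prod.snd_add]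
  constructor <;> rintro ⟨⟨_, _⟩, _, _⟩ <;> refine ⟨⟨?_, ?_⟩, ?_, ?_⟩ <;> linarith

theorem integrableOn_cube {F : ℝ × ℝ → ℂ} (hF : Measurable F) {C : ℝ} (hC : ∀ᵐ z, ‖F z‖ ≤ C)
    (c : ℝ × ℝ) {δ : ℝ} (hδ : 0 < δ) : IntegrableOn F (cube c δ) :=
  Measure.integrableOn_of_bounded (volume_cube_lt_top c hδ).ne hF.aestronglyMeasurable
    (ae_restrict_of_ae hC)

theorem integrableOn_cube_const {E : Type*} [NormedAddCommGroup E] (a : E) (c : ℝ × ℝ) {δ : ℝ}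
    (hδ : 0 < δ) : IntegrableOn (fun _ => a) (cube c δ) :=
  integrableOn_const (volume_cube_lt_top c hδ).ne

/-- Bounded functions of locally vanishing mean oscillation: `F` is measurable, bounded by a
constant `C`, and on small squares, locally uniformly in their position, it is close in mean to
constants bounded by `C`. Measurability is required exactly, not up to null sets; `zak g` has it. -/
def IsBddVMO (F : ℝ × ℝ → ℂ) : Prop :=
  Measurable F ∧ ∃ C : ℝ, 0 ≤ C ∧ (∀ᵐ z, ‖F z‖ ≤ C) ∧ ∀ R η : ℝ, 0 < η → ∃ δ₀ > 0,
    ∀ (c : ℝ × ℝ) (δ : ℝ), 0 < δ → δ < δ₀ → ‖c‖ ≤ R →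
      ∃ a : ℂ, ‖a‖ ≤ C ∧ ∫ z in cube c δ, ‖F z - a‖ ≤ η * δ ^ 2

namespace IsBddVMO

variable {F G : ℝ × ℝ → ℂ}

theorem of_uniformContinuous (hF : UniformContinuous F) {C : ℝ} (hC : ∀ z, ‖F z‖ ≤ C) :
    IsBddVMO F := by
  refine ⟨hF.continuous.measurable, C, (norm_nonneg _).trans (hC 0), ae_of_all _ hC,
    fun R η hη => ?_⟩
  obtain ⟨δ₀, hδ₀, h⟩ := Metric.uniformContinuous_iff.1 hF η hη
  refine ⟨δ₀, hδ₀, fun c δ hδ hδ' _ => ⟨F c, hC c, ?_⟩⟩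
  rw [← volume_real_cube c hδ]
  refine (Real.le_norm_self _).trans ?_
  refine norm_setIntegral_le_of_norm_le_const (volume_cube_lt_top c hδ) fun z hz => ?_
  have hzc := (Metric.mem_closedBall.1 (cube_subset_closedBall c δ hz)).trans_lt hδ'
  simpa [dist_eq_norm] using (h hzc).le

theorem const (a : ℂ) : IsBddVMO fun _ => a :=
  of_uniformContinuous uniformContinuous_const fun _ => le_rfl

theorem add (hF : IsBddVMO F) (hG : IsBddVMO G) : IsBddVMO fun z => F z + G z := by
  obtain ⟨mF, C, hC0, hC, oF⟩ := hF
  obtain ⟨mG, D, hD0, hD, oG⟩ := hG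
  refine ⟨mF.add mG, C + D, by positivity, ?_, fun R η hη => ?_⟩
  · filter_upwards [hC, hD] with z h1 h2
    exact (norm_add_le _ _).trans (by linarith)
  obtain ⟨δ₁, hδ₁, h1⟩ := oF R (η / 2) (by positivity)
  obtain ⟨δ₂, hδ₂, h2⟩ := oG R (η / 2) (by positivity)
  refine ⟨min δ₁ δ₂, lt_min hδ₁ hδ₂, fun c δ hδ hδ' hc => ?_⟩
  obtain ⟨a, ha, ha'⟩ := h1 c δ hδ (hδ'.trans_le (min_le_left _ _)) hc
  obtain ⟨b, hb, hb'⟩ := h2 c δ hδ (hδ'.trans_le (min_le_right _ _)) hc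
  have iF := ((integrableOn_cube mF hC c hδ).sub (integrableOn_cube_const a c hδ)).norm
  have iG := ((integrableOn_cube mG hD c hδ).sub (integrableOn_cube_const b c hδ)).norm
  refine ⟨a + b, (norm_add_le _ _).trans (by linarith), ?_⟩
  calc ∫ z in cube c δ, ‖F z + G z - (a + b)‖
      ≤ ∫ z in cube c δ, (‖F z - a‖ + ‖G z - b‖) := by
        refine integral_mono_of_nonneg (ae_of_all _ fun _ => norm_nonneg _) (iF.add iG)
          (ae_of_all _ fun z => ?_)
        simp only
        rw [show F z + G z - (a + b) = (F z - a) + (G z - b) by ring]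
        exact norm_add_le _ _
    _ = (∫ z in cube c δ, ‖F z - a‖) + ∫ z in cube c δ, ‖G z - b‖ := integral_add iF iG
    _ ≤ η * δ ^ 2 := by linarith

/-- Bounded functions of vanishing mean oscillation form an algebra, since
`FG - ab = F (G - b) + b (F - a)`. -/
theorem mul (hF : IsBddVMO F) (hG : IsBddVMO G) : IsBddVMO fun z => F z * G z := by
  obtain ⟨mF, C, hC0, hC, oF⟩ := hF
  obtain ⟨mG, D, hD0, hD, oG⟩ := hG
  refine ⟨mF.mul mG, C * D, by positivity, ?_, fun R η hη => ?_⟩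
  · filter_upwards [hC, hD] with z h1 h2
    rw [norm_mul]
    gcongr
  set ε := η / (C + D + 1) with hε
  have hε0 : 0 < ε := by positivity
  obtain ⟨δ₁, hδ₁, h1⟩ := oF R ε hε0
  obtain ⟨δ₂, hδ₂, h2⟩ := oG R ε hε0
  refine ⟨min δ₁ δ₂, lt_min hδ₁ hδ₂, fun c δ hδ hδ' hc => ?_⟩
  obtain ⟨a, ha, ha'⟩ := h1 c δ hδ (hδ'.trans_le (min_le_left _ _)) hc
  obtain ⟨b, hb, hb'⟩ := h2 c δ hδ (hδ'.trans_le (min_le_right _ _)) hc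
  have iF :=
    (((integrableOn_cube mF hC c hδ).sub (integrableOn_cube_const a c hδ)).norm).const_mul D
  have iG :=
    (((integrableOn_cube mG hD c hδ).sub (integrableOn_cube_const b c hδ)).norm).const_mul C
  refine ⟨a * b, by rw [norm_mul]; gcongr, ?_⟩
  calc ∫ z in cube c δ, ‖F z * G z - a * b‖
      ≤ ∫ z in cube c δ, (D * ‖F z - a‖ + C * ‖G z - b‖) := by
        refine integral_mono_of_nonneg (ae_of_all _ fun _ => norm_nonneg _) (iF.add iG)
          (ae_restrict_of_ae ?_)
        filter_upwards [hC] with z hz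
        rw [show F z * G z - a * b = b * (F z - a) + F z * (G z - b) by ring]
        refine (norm_add_le _ _).trans ?_
        rw [norm_mul, norm_mul]
        gcongr
    _ = D * (∫ z in cube c δ, ‖F z - a‖) + C * ∫ z in cube c δ, ‖G z - b‖ := by
        rw [← integral_const_mul, ← integral_const_mul]
        exact integral_add iF iG
    _ ≤ D * (ε * δ ^ 2) + C * (ε * δ ^ 2) := by gcongr
    _ ≤ (C + D + 1) * ε * δ ^ 2 := by nlinarith [mul_pos hε0 (pow_pos hδ 2)]
    _ = η * δ ^ 2 := by rw [hε]; field_simp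

theorem sum {ι : Type*} (s : Finset ι) {F : ι → ℝ × ℝ → ℂ} (hF : ∀ i ∈ s, IsBddVMO (F i)) :
    IsBddVMO fun z => ∑ i ∈ s, F i z := by
  classical
  induction s using Finset.induction_on with
  | empty => simpa using const 0
  | insert i s hi ih =>
    simp_rw [Finset.sum_insert hi]
    exact (hF i (Finset.mem_insert_self i s)).add
      (ih fun j hj => hF j (Finset.mem_insert_of_mem hj))

theorem prod {ι : Type*} (s : Finset ι) {F : ι → ℝ × ℝ → ℂ} (hF : ∀ i ∈ s, IsBddVMO (F i)) :
    IsBddVMO fun z => ∏ i ∈ s, F i z := by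
  classical
  induction s using Finset.induction_on with
  | empty => simpa using const 1
  | insert i s hi ih =>
    simp_rw [Finset.prod_insert hi]
    exact (hF i (Finset.mem_insert_self i s)).mul
      (ih fun j hj => hF j (Finset.mem_insert_of_mem hj))

theorem det {ι : Type*} [Fintype ι] [DecidableEq ι] {M : ℝ × ℝ → Matrix ι ι ℂ}
    (hM : ∀ i j, IsBddVMO fun z => M z i j) : IsBddVMO fun z => (M z).det := by
  simp_rw [Matrix.det_apply']
  exact sum _ fun σ _ => (const _).mul (prod _ fun i _ => hM _ _)

theorem translate (hF : IsBddVMO F) (s : ℝ × ℝ) : IsBddVMO fun z => F (z + s) := by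
  obtain ⟨mF, C, hC0, hC, oF⟩ := hF
  refine ⟨mF.comp (measurable_add_const s), C, hC0,
    (measurePreserving_add_right volume s).quasiMeasurePreserving.ae hC, fun R η hη => ?_⟩
  obtain ⟨δ₀, hδ₀, h⟩ := oF (R + ‖s‖) η hη
  refine ⟨δ₀, hδ₀, fun c δ hδ hδ' hc => ?_⟩
  obtain ⟨a, ha, ha'⟩ := h (c + s) δ hδ hδ' ((norm_add_le _ _).trans (by linarith))
  refine ⟨a, ha, ?_⟩
  rwa [setIntegral_cube_add fun z => ‖F z - a‖]

/-- An essentially bounded function in `VMO_loc`: the constants are its averages. -/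
theorem of_isVMOLoc (hF : IsVMOLoc F) (mF : Measurable F) {C : ℝ} (hC : ∀ᵐ z, ‖F z‖ ≤ C) :
    IsBddVMO F := by
  have hC0 : 0 ≤ C := by
    obtain ⟨z, hz⟩ := hC.exists
    exact (norm_nonneg _).trans hz
  refine ⟨mF, C, hC0, hC, fun R η hη => ?_⟩
  have hV := (hF (Metric.ball 0 (R + 1)) Metric.isOpen_ball Metric.isBounded_ball).2
  have hev := hV.eventually (gt_mem_nhds (ENNReal.ofReal_pos.2 hη))
  obtain ⟨ε, hε, hε0⟩ := (hev.and self_mem_nhdsWithin).exists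
  replace hε0 : 0 < ε := hε0
  refine ⟨min 1 (Real.sqrt ε), lt_min one_pos (Real.sqrt_pos.2 hε0), fun c δ hδ hδ' hc => ?_⟩
  refine ⟨⨍ q in cube c δ, F q, ?_, ?_⟩
  · rw [setAverage_eq, volume_real_cube c hδ, norm_smul, norm_inv, Real.norm_of_nonneg
      (by positivity), inv_mul_le_iff₀ (by positivity), mul_comm, ← volume_real_cube c hδ]
    exact norm_setIntegral_le_of_norm_le_const_ae (volume_cube_lt_top c hδ)
      (ae_restrict_of_ae hC)
  · have hsub : cube c δ ⊆ Metric.ball 0 (R + 1) := fun z hz => by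
      have h1 := (Metric.mem_closedBall.1 (cube_subset_closedBall c δ hz)).trans_lt
        (hδ'.trans_le (min_le_left _ _))
      rw [mem_ball_zero_iff]
      rw [dist_eq_norm] at h1
      calc ‖z‖ = ‖(z - c) + c‖ := by simp
        _ ≤ ‖z - c‖ + ‖c‖ := norm_add_le _ _
        _ < R + 1 := by linarith
    have hvol : volume (cube c δ) < ENNReal.ofReal ε := by
      rw [volume_cube c hδ]
      exact (ENNReal.ofReal_lt_ofReal_iff hε0).2
        ((Real.lt_sqrt hδ.le).1 (hδ'.trans_le (min_le_right _ _)))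
    have h1 : ENNReal.ofReal (meanOsc F (cube c δ)) ≤ oscSup ε (Metric.ball 0 (R + 1)) F :=
      le_iSup_of_le c <| le_iSup_of_le δ <| le_iSup_of_le hδ <| le_iSup_of_le hsub <|
        le_iSup_of_le hvol le_rfl
    have h2 := ((ENNReal.ofReal_lt_ofReal_iff hη).1 (h1.trans_lt hε)).le
    rw [meanOsc, setAverage_eq, volume_real_cube c hδ, smul_eq_mul,
      inv_mul_le_iff₀ (by positivity)] at h2
    linarith

theorem continuous_setIntegral_cube (mF : Measurable F) {C : ℝ} (hC : ∀ᵐ z, ‖F z‖ ≤ C) {δ : ℝ}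
    (hδ : 0 < δ) : Continuous fun c => ∫ z in cube c δ, F z := by
  have hC0 : 0 ≤ C := by
    obtain ⟨z, hz⟩ := hC.exists
    exact (norm_nonneg _).trans hz
  simp_rw [← integral_indicator (measurableSet_cube _ δ)]
  rw [continuous_iff_continuousAt]
  intro c
  refine continuousAt_of_dominated
    (bound := (cube (c - (1, 1)) (δ + 2)).indicator fun _ => C) ?_ ?_ ?_ ?_
  · exact Eventually.of_forall fun c' =>
      (mF.indicator (measurableSet_cube c' δ)).aestronglyMeasurable
  · filter_upwards [Metric.closedBall_mem_nhds c one_pos] with c' hc'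
    filter_upwards [hC] with z hz
    by_cases hzc : z ∈ cube c' δ
    · have : z ∈ cube (c - (1, 1)) (δ + 2) := by
        rw [Metric.mem_closedBall, Prod.dist_eq, max_le_iff, Real.dist_eq, Real.dist_eq, abs_le,
          abs_le] at hc'
        obtain ⟨⟨_, _⟩, _, _⟩ := hzc
        obtain ⟨⟨_, _⟩, _, _⟩ := hc'
        refine ⟨⟨?_, ?_⟩, ?_, ?_⟩ <;> simp only [Prod.fst_sub, Prod.snd_sub] <;> linarith
      rwa [indicator_of_mem hzc, indicator_of_mem this]
    · rw [indicator_of_notMem hzc, norm_zero]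
      exact indicator_nonneg (fun _ _ => hC0) z
  · exact (integrable_indicator_iff (measurableSet_cube _ _)).2
      (integrableOn_cube_const C _ (by linarith))
  · -- off the four lines that carry the boundary of the square, membership is locally constant
    have h1 : ∀ t : ℝ, ∀ᵐ z : ℝ × ℝ, z.1 ≠ t := fun t =>
      Measure.quasiMeasurePreserving_fst.ae (Measure.ae_ne volume t)
    have h2 : ∀ t : ℝ, ∀ᵐ z : ℝ × ℝ, z.2 ≠ t := fun t =>
      Measure.quasiMeasurePreserving_snd.ae (Measure.ae_ne volume t)
    filter_upwards [h1 c.1, h1 (c.1 + δ), h2 c.2, h2 (c.2 + δ)] with z ha hb hc hd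
    have key : ∀ᶠ c' in 𝓝 c, (z ∈ cube c' δ ↔ z ∈ cube c δ) := by
      have e : ∀ (f : ℝ × ℝ → ℝ) (t : ℝ), Continuous f → t ≠ f c →
          ∀ᶠ c' in 𝓝 c, (f c' ≤ t ↔ f c ≤ t) ∧ (t ≤ f c' ↔ t ≤ f c) := by
        intro f t hf ht
        rcases lt_or_gt_of_ne ht with h | h
        · filter_upwards [hf.continuousAt.eventually (lt_mem_nhds h)] with c' hc'
          exact ⟨iff_of_false hc'.not_ge h.not_ge, iff_of_true hc'.le h.le⟩
        · filter_upwards [hf.continuousAt.eventually (gt_mem_nhds h)] with c' hc'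
          exact ⟨iff_of_true hc'.le h.le, iff_of_false hc'.not_ge h.not_ge⟩
      filter_upwards [e (fun c => c.1) z.1 (by fun_prop) ha,
        e (fun c => c.1 + δ) z.1 (by fun_prop) hb, e (fun c => c.2) z.2 (by fun_prop) hc,
        e (fun c => c.2 + δ) z.2 (by fun_prop) hd] with c' h1 h2 h3 h4
      simp only [cube, mem_prod, mem_Icc]
      rw [h1.1, h2.2, h3.1, h4.2]
    refine ContinuousAt.congr (continuousAt_const (y := (cube c δ).indicator F z)) ?_
    filter_upwards [key] with c' hc'
    by_cases h : z ∈ cube c δ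
    · rw [indicator_of_mem h, indicator_of_mem (hc'.2 h)]
    · rw [indicator_of_notMem h, indicator_of_notMem fun h' => h (hc'.1 h')]

/-- A bounded function of vanishing mean oscillation that is bounded away from `0` has a winding
number: if `D(x + 1, ω) = e^{2πi(nω + θ)} D(x, ω)` and `D(x, ω + 1) = D(x, ω)`, then `n = 0`.
The averages of `D` over small squares are continuous, do not vanish, and almost inherit the
quasi-periodicity. -/
theorem eq_zero_of_quasiperiodic {D : ℝ × ℝ → ℂ} (hD : IsBddVMO D) {κ : ℝ} (hκ : 0 < κ)
    (hlow : ∀ᵐ z, κ ≤ ‖D z‖) (n : ℤ) (θ : ℝ)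
    (hx : ∀ x w, D (x + 1, w) = unitExp (n * w + θ) * D (x, w))
    (hw : ∀ x w, D (x, w + 1) = D (x, w)) : n = 0 := by
  obtain ⟨mD, C, hC0, hC, oD⟩ := hD
  obtain ⟨δ₀, hδ₀, hosc⟩ := oD 1 (κ / 4) (by positivity)
  set K := 2 * Real.pi * |(n : ℝ)| * C with hK
  have hK0 : 0 ≤ K := by positivity
  obtain ⟨δ, hδ, hδ'⟩ := exists_between (lt_min hδ₀ (show 0 < κ / (2 * (K + 1)) by positivity))
  have hδ0 : δ < δ₀ := hδ'.trans_le (min_le_left _ _)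
  have hδK : K * δ < κ / 2 := by
    have := hδ'.trans_le (min_le_right _ _)
    rw [lt_div_iff₀ (by positivity)] at this
    nlinarith
  have hint := fun c : ℝ × ℝ => integrableOn_cube mD hC c hδ
  set A : ℝ × ℝ → ℂ := fun c => ∫ z in cube c δ, D z with hA
  have hAc : Continuous A := continuous_setIntegral_cube mD hC hδ
  have hAper : ∀ x w, A (x, w + 1) = A (x, w) := fun x w => by
    have := setIntegral_cube_add D (x, w) (0, 1) δ
    simp only [Prod.mk_add_mk, add_zero] at this
    rw [hA]
    simp only
    rw [← this]
    congr 1 with z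
    rw [← hw z.1 z.2]
    simp [Prod.add_def]
  have hAlow' : ∀ c, ‖c‖ ≤ 1 → κ / 2 * δ ^ 2 ≤ ‖A c‖ := by
    intro c hc
    obtain ⟨a, -, ha⟩ := hosc c δ hδ hδ0 hc
    have ia := integrableOn_cube_const a c hδ
    have i1 : IntegrableOn (fun z => ‖D z - a‖) (cube c δ) := ((hint c).sub ia).norm
    have e1 : ‖A c - δ ^ 2 * a‖ ≤ κ / 4 * δ ^ 2 := by
      refine le_trans ?_ ha
      have : A c - δ ^ 2 * a = ∫ z in cube c δ, (D z - a) := by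
        rw [integral_sub (hint c) ia, setIntegral_const, volume_real_cube c hδ, Complex.real_smul]
        push_cast
        rfl
      rw [this]
      exact norm_integral_le_integral_norm _
    have e2 : κ * δ ^ 2 ≤ κ / 4 * δ ^ 2 + δ ^ 2 * ‖a‖ := by
      have : ∫ z in cube c δ, κ ≤ ∫ z in cube c δ, (‖D z - a‖ + ‖a‖) := by
        refine integral_mono_ae (integrableOn_cube_const κ c hδ)
          (i1.add (integrableOn_cube_const ‖a‖ c hδ)) (ae_restrict_of_ae ?_)
        filter_upwards [hlow] with z hz
        have := norm_add_le (D z - a) a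
        rw [sub_add_cancel] at this
        exact hz.trans this
      rw [integral_add i1 (integrableOn_cube_const ‖a‖ c hδ), setIntegral_const,
        setIntegral_const, volume_real_cube c hδ, smul_eq_mul, smul_eq_mul] at this
      linarith
    have e3 : δ ^ 2 * ‖a‖ ≤ ‖A c‖ + ‖A c - δ ^ 2 * a‖ := by
      have : ‖((δ ^ 2 : ℝ) : ℂ) * a‖ = δ ^ 2 * ‖a‖ := by
        rw [norm_mul, Complex.norm_real, Real.norm_of_nonneg (by positivity)]
      rw [← this]
      push_cast
      rw [← norm_neg (A c - δ ^ 2 * a)]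
      refine le_trans (le_of_eq ?_) (norm_add_le _ _)
      congr 1
      ring
    linarith
  have hAlow : ∀ x ∈ Icc (0 : ℝ) 1, ∀ w, κ / 2 * δ ^ 2 ≤ ‖A (x, w)‖ := by
    intro x hx w
    have hp : Function.Periodic (fun w => A (x, w)) 1 := fun w => hAper x w
    have : A (x, w) = A (x, Int.fract w) := by
      have := hp.sub_int_mul_eq ⌊w⌋ (x := w)
      simp only [mul_one] at this
      exact this.symm
    rw [this]
    refine hAlow' _ ?_
    rw [Prod.norm_def, Real.norm_of_nonneg hx.1, Real.norm_of_nonneg (Int.fract_nonneg w)]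
    exact max_le hx.2 (Int.fract_lt_one w).le
  have hpos : 0 < κ / 2 * δ ^ 2 := by positivity
  set p : ℝ → ℝ := fun x => max 0 (min 1 x) with hp
  have hpI : ∀ x, p x ∈ Icc (0 : ℝ) 1 := fun x =>
    ⟨le_max_left _ _, max_le zero_le_one (min_le_left _ _)⟩
  refine winding_eq_zero (H := fun z => A (p z.1, z.2)) (by fun_prop)
    (fun z => norm_pos_iff.1 (hpos.trans_le (hAlow _ (hpI _) _))) (fun x w => hAper _ _) n θ
    fun w => ?_
  have p0 : p 0 = 0 := by simp [hp]
  have p1 : p 1 = 1 := by simp [hp]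
  simp only [p0, p1]
  refine lt_of_lt_of_le ?_ (hAlow 0 (by simp) w)
  have e1 : A (1, w) = ∫ z in cube (0, w) δ, unitExp (n * z.2 + θ) * D z := by
    have := setIntegral_cube_add D (0, w) (1, 0) δ
    simp only [Prod.mk_add_mk, add_zero, zero_add] at this
    rw [hA]
    simp only
    rw [← this]
    congr 1 with z
    rw [← hx z.1 z.2]
    simp [Prod.add_def]
  have e2 : unitExp (n * w + θ) * A (0, w) =
      ∫ z in cube (0, w) δ, unitExp (n * w + θ) * D z := (integral_const_mul _ _).symm
  have i2 : IntegrableOn (fun z : ℝ × ℝ => unitExp (n * z.2 + θ) * D z) (cube (0, w) δ) := by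
    refine integrableOn_cube (C := C) (by fun_prop) ?_ _ hδ
    filter_upwards [hC] with z hz
    rwa [norm_mul, norm_unitExp, one_mul]
  rw [e1, e2, ← integral_sub i2 ((hint _).const_mul _)]
  calc ‖∫ z in cube (0, w) δ, (unitExp (n * z.2 + θ) * D z - unitExp (n * w + θ) * D z)‖
      ≤ K * δ * volume.real (cube (0, w) δ) := by
        refine norm_setIntegral_le_of_norm_le_const_ae (volume_cube_lt_top _ hδ) ?_
        filter_upwards [ae_restrict_of_ae hC, ae_restrict_mem (measurableSet_cube _ _)]
          with z hz hzc
        rw [← sub_mul, norm_mul]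
        have h1 := norm_unitExp_sub_le (n * z.2 + θ) (n * w + θ)
        have h2 : |n * z.2 + θ - (n * w + θ)| ≤ |(n : ℝ)| * δ := by
          rw [show n * z.2 + θ - (n * w + θ) = n * (z.2 - w) by ring, abs_mul]
          gcongr
          have := hzc.2
          simp only [mem_Icc] at this
          exact abs_le.2 ⟨by linarith, by linarith⟩
        calc _ ≤ (2 * Real.pi * (|(n : ℝ)| * δ)) * C := by
              have := Real.two_pi_pos
              gcongr
              exact h1.trans (by gcongr)
          _ = K * δ := by rw [hK]; ring
    _ < κ / 2 * δ ^ 2 := by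
        rw [volume_real_cube _ hδ]
        gcongr

end IsBddVMO

/-! ### Cosets in rational lattices -/

theorem exists_common_denominator (A : Matrix (Fin 2) (Fin 2) ℚ) :
    ∃ (N : ℕ) (B : Matrix (Fin 2) (Fin 2) ℤ), 0 < N ∧ ∀ i j, (B i j : ℚ) = N * A i j := by
  have h : ∀ i j, (A i j).den ∣ ∏ i, ∏ j, (A i j).den := fun i j =>
    (Finset.dvd_prod_of_mem (fun j => (A i j).den) (Finset.mem_univ j)).trans
      (Finset.dvd_prod_of_mem (fun i => ∏ j, (A i j).den) (Finset.mem_univ i))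
  choose c hc using h
  refine ⟨∏ i, ∏ j, (A i j).den, Matrix.of fun i j => (A i j).num * c i j,
    Finset.prod_pos fun i _ => Finset.prod_pos fun j _ => (A i j).pos, fun i j => ?_⟩
  rw [hc i j]
  have : ((A i j).den : ℚ) * A i j = (A i j).num := by
    rw [mul_comm]; exact Rat.mul_den_eq_num _
  simp only [Matrix.of_apply]
  push_cast
  rw [← this]
  ring

/-- The cokernel of an integer matrix with nonzero determinant has `|det C|` elements. -/
theorem card_quotient_range_toLin' (C : Matrix (Fin 2) (Fin 2) ℤ) (hC : C.det ≠ 0) :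
    Nat.card ((Fin 2 → ℤ) ⧸ LinearMap.range (Matrix.toLin' C)) = C.det.natAbs := by
  have hinj : Function.Injective (Matrix.toLin' C) := by
    rw [Matrix.toLin'_apply']
    exact Matrix.mulVec_injective_of_det_ne_zero hC
  rw [← Submodule.natAbs_det_equiv _ (LinearEquiv.ofInjective _ hinj)]
  congr 1
  rw [← LinearMap.det_toLin' C]
  rfl

/-- A lattice `Λ = Aℤ²` with `A` rational and `det A = 1` contains `Nℤ²` for some `N ≥ 1`, with
`NΛ ⊆ ℤ²`, and then `Nℤ²` has index `N²` in `Λ`: the `lam j` represent its cosets. -/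
theorem exists_cosets_latticeOf (A : Matrix (Fin 2) (Fin 2) ℚ) (hA : A.det = 1) :
    ∃ (N : ℕ) (lam : Fin N × Fin N → Fin 2 → ℝ), 0 < N ∧
      (∀ j i, ∃ m : ℤ, N * lam j i = m) ∧
      (∀ j (m : Fin 2 → ℤ), (fun i => lam j i + N * m i) ∈ latticeOf A) ∧
      Function.Injective fun (p : (Fin N × Fin N) × (Fin 2 → ℤ)) i =>
        lam p.1 i + N * (p.2 i : ℝ) := by
  obtain ⟨N, B, hN, hB⟩ := exists_common_denominator A
  have hdet : B.det = (N : ℤ) ^ 2 := by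
    have : ((B.det : ℤ) : ℚ) = ((N : ℤ) ^ 2 : ℤ) := by
      rw [Matrix.det_fin_two] at hA ⊢
      push_cast
      rw [hB, hB, hB, hB]
      linear_combination (N : ℚ) ^ 2 * hA
    exact_mod_cast this
  set C := B.adjugate with hCdef
  have hCdet : C.det = (N : ℤ) ^ 2 := by
    rw [hCdef, Matrix.det_adjugate, hdet]; simp
  have hC0 : C.det ≠ 0 := by
    rw [hCdet]
    have : (N : ℤ) ≠ 0 := by exact_mod_cast hN.ne'
    positivity
  have hCinj : Function.Injective C.mulVec := Matrix.mulVec_injective_of_det_ne_zero hC0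
  set AR : Matrix (Fin 2) (Fin 2) ℝ := A.map fun q : ℚ => (q : ℝ) with hAR
  have hARdet : AR.det ≠ 0 := by
    rw [Matrix.det_fin_two] at hA ⊢
    simp only [hAR, Matrix.map_apply]
    have : ((A 0 0 * A 1 1 - A 0 1 * A 1 0 : ℚ) : ℝ) = 1 := by rw [hA]; simp
    push_cast at this
    rw [this]
    exact one_ne_zero
  have hARinj : Function.Injective AR.mulVec := Matrix.mulVec_injective_of_det_ne_zero hARdet
  -- `A * C = N`, read on integer vectors
  have hAC : ∀ m : Fin 2 → ℤ,
      AR.mulVec (fun i => ((C.mulVec m) i : ℝ)) = fun i => N * (m i : ℝ) := by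
    intro m
    have hBR : ∀ i j, (B i j : ℝ) = N * AR i j := fun i j => by
      have := hB i j
      simp only [hAR, Matrix.map_apply]
      exact_mod_cast this
    have hd : (B.det : ℝ) = (N : ℝ) ^ 2 := by rw [hdet]; push_cast; rfl
    have hNR : (N : ℝ) ≠ 0 := by exact_mod_cast hN.ne'
    rw [Matrix.det_fin_two] at hd
    push_cast at hd
    have hcol : ∀ i, AR.mulVec (fun i => ((C.mulVec m) i : ℝ)) i =
        AR i 0 * (B 1 1 * m 0 - B 0 1 * m 1) + AR i 1 * (-B 1 0 * m 0 + B 0 0 * m 1) := fun i => by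
      simp only [Matrix.mulVec, dotProduct, Fin.sum_univ_two, hCdef, Matrix.adjugate_fin_two,
        Matrix.of_apply, Matrix.cons_val_zero, Matrix.cons_val_one]
      simp [sub_eq_add_neg]
    ext i
    rw [hcol]
    apply mul_left_cancel₀ hNR
    fin_cases i
    · have h1 := hBR 0 0
      have h2 := hBR 0 1
      simp only [Fin.zero_eta, Fin.isValue]
      linear_combination (m 0 : ℝ) * hd - (B 1 1 * (m 0 : ℝ) - B 0 1 * m 1) * h1
        - (-(B 1 0 : ℝ) * m 0 + B 0 0 * m 1) * h2
    · have h1 := hBR 1 0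
      have h2 := hBR 1 1
      simp only [Fin.mk_one, Fin.isValue]
      linear_combination (m 1 : ℝ) * hd - (B 1 1 * (m 0 : ℝ) - B 0 1 * m 1) * h1
        - (-(B 1 0 : ℝ) * m 0 + B 0 0 * m 1) * h2
  set Q := (Fin 2 → ℤ) ⧸ LinearMap.range (Matrix.toLin' C)
  have hcard : Nat.card Q = Nat.card (Fin N × Fin N) := by
    rw [card_quotient_range_toLin' C hC0, hCdet]
    simp [Int.natAbs_mul, sq]
  have : Finite Q := Nat.finite_of_card_ne_zero (by rw [hcard]; simp [hN.ne'])
  let e : Fin N × Fin N ≃ Q := (Finite.card_eq.1 hcard.symm).some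
  obtain ⟨rep, hrep⟩ :=
    (Submodule.mkQ_surjective (LinearMap.range (Matrix.toLin' C))).hasRightInverse
  set k : Fin N × Fin N → Fin 2 → ℤ := fun j => rep (e j)
  have hsum : ∀ j (m : Fin 2 → ℤ), AR.mulVec (fun i => ((k j + C.mulVec m) i : ℝ)) =
      fun i => AR.mulVec (fun i => (k j i : ℝ)) i + N * (m i : ℝ) := by
    intro j m
    ext i
    rw [← congrFun (hAC m) i, ← Pi.add_apply, ← Matrix.mulVec_add]
    congr 2
    ext i
    simp
  refine ⟨N, fun j => AR.mulVec fun i => (k j i : ℝ), hN, fun j i => ?_, fun j m => ?_, ?_⟩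
  · refine ⟨(B.mulVec (k j)) i, ?_⟩
    simp only [Matrix.mulVec, dotProduct, Fin.sum_univ_two, hAR, Matrix.map_apply]
    have h0 := hB i 0
    have h1 := hB i 1
    have h0' : (B i 0 : ℝ) = N * (A i 0 : ℝ) := by exact_mod_cast h0
    have h1' : (B i 1 : ℝ) = N * (A i 1 : ℝ) := by exact_mod_cast h1
    push_cast
    rw [h0', h1']
    ring
  · exact ⟨k j + C.mulVec m, hsum j m⟩
  · rintro ⟨j, m⟩ ⟨j', m'⟩ h
    simp only at h
    rw [← hsum, ← hsum] at h
    have h1 := hARinj h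
    have h2 : k j + C.mulVec m = k j' + C.mulVec m' := by
      ext i
      exact_mod_cast congrFun h1 i
    have h3 : e j = e j' := by
      have := congrArg (Submodule.mkQ (LinearMap.range (Matrix.toLin' C))) h2
      rw [map_add, map_add, hrep, hrep] at this
      have hz : ∀ m, Submodule.mkQ (LinearMap.range (Matrix.toLin' C)) (C.mulVec m) = 0 := fun m =>
        (Submodule.Quotient.mk_eq_zero _).2 ⟨m, by simp⟩
      rwa [hz, hz, add_zero, add_zero] at this
    have h4 := e.injective h3
    subst h4
    rw [hCinj (add_left_cancel h2)]

/-! ### The Zak transform and time-frequency shifts -/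

theorem unitExp_neg_mul (k : ℤ) (t : ℝ) :
    Complex.exp (-(2 * Real.pi * Complex.I * k * t)) = unitExp (-(k * t)) := by
  rw [unitExp]
  push_cast
  ring_nf

theorem exp_eq_unitExp (s t : ℝ) :
    Complex.exp (2 * Real.pi * Complex.I * s * t) = unitExp (s * t) := by
  rw [unitExp]
  push_cast
  ring_nf

theorem zak_eq (f : Lp ℂ 2 (volume : Measure ℝ)) (p : ℝ × ℝ) :
    zak f p = unitExp (⌊p.1⌋ * p.2) * zakSquare f (Int.fract p.1, Int.fract p.2) := by
  rw [zak, ← exp_eq_unitExp]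
  push_cast
  rfl

theorem zak_add_intCast (f : Lp ℂ 2 (volume : Measure ℝ)) (x w : ℝ) (m n : ℤ) :
    zak f (x + m, w + n) = unitExp (m * w) * zak f (x, w) := by
  rw [zak_add_int, ← exp_eq_unitExp]
  push_cast
  rfl

@[fun_prop]
theorem measurable_zak (f : Lp ℂ 2 (volume : Measure ℝ)) : Measurable (zak f) := by
  have h : zak f = fun p => unitExp (⌊p.1⌋ * p.2) * zakSquare f (Int.fract p.1, Int.fract p.2) :=
    funext fun p => zak_eq f p
  rw [h]
  have := (Lp.stronglyMeasurable (zakSquare f)).measurable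
  fun_prop

theorem measurableSet_unitSquare : MeasurableSet unitSquare :=
  measurableSet_Icc.prod measurableSet_Icc

theorem fract_mem_unitSquare (z : ℝ × ℝ) : (Int.fract z.1, Int.fract z.2) ∈ unitSquare :=
  ⟨⟨Int.fract_nonneg _, (Int.fract_lt_one _).le⟩, Int.fract_nonneg _, (Int.fract_lt_one _).le⟩

theorem ae_fract_of_ae_unitSquare {P : ℝ × ℝ → Prop}
    (h : ∀ᵐ p ∂(volume : Measure (ℝ × ℝ)).restrict unitSquare, P p) :
    ∀ᵐ z : ℝ × ℝ, P (Int.fract z.1, Int.fract z.2) := by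
  rw [ae_restrict_iff' measurableSet_unitSquare] at h
  have h2 : ∀ᵐ z : ℝ × ℝ, ∀ k : ℤ × ℤ, z - ((k.1 : ℝ), (k.2 : ℝ)) ∈ unitSquare →
      P (z - ((k.1 : ℝ), (k.2 : ℝ))) := ae_all_iff.2 fun k =>
    (measurePreserving_sub_right volume ((k.1 : ℝ), (k.2 : ℝ))).quasiMeasurePreserving.ae h
  filter_upwards [h2] with z hz
  exact hz (⌊z.1⌋, ⌊z.2⌋) (fract_mem_unitSquare z)

theorem zak_ae_eq_zakSquare (f : Lp ℂ 2 (volume : Measure ℝ)) :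
    zak f =ᵐ[(volume : Measure (ℝ × ℝ)).restrict unitSquare] zakSquare f := by
  have h1 : ∀ᵐ z : ℝ × ℝ, z.1 ≠ 1 := Measure.quasiMeasurePreserving_fst.ae (Measure.ae_ne volume 1)
  have h2 : ∀ᵐ z : ℝ × ℝ, z.2 ≠ 1 := Measure.quasiMeasurePreserving_snd.ae (Measure.ae_ne volume 1)
  filter_upwards [ae_restrict_mem measurableSet_unitSquare, ae_restrict_of_ae h1,
    ae_restrict_of_ae h2] with z hz ha hb
  have e1 : ⌊z.1⌋ = 0 := Int.floor_eq_zero_iff.2 ⟨hz.1.1, lt_of_le_of_ne hz.1.2 ha⟩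
  have e2 : ⌊z.2⌋ = 0 := Int.floor_eq_zero_iff.2 ⟨hz.2.1, lt_of_le_of_ne hz.2.2 hb⟩
  have e0 : unitExp 0 = 1 := by simpa using unitExp_int 0
  rw [zak_eq, Int.fract, Int.fract, e1, e2]
  simp [e0]

/-- The Zak transform on the unit square as a linear isometry. -/
noncomputable def zakIsometry : Lp ℂ 2 (volume : Measure ℝ) →ₗᵢ[ℂ]
    Lp ℂ 2 ((volume : Measure (ℝ × ℝ)).restrict unitSquare) where
  toFun := zakSquare
  map_add' f g := by
    have hT : ∀ k : ℤ, zakTerm (f + g) k = zakTerm f k + zakTerm g k := fun k => by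
      apply Lp.ext
      have hx : ∀ᵐ x : ℝ, (f + g : Lp ℂ 2 volume) (x + k) = f (x + k) + g (x + k) :=
        (measurePreserving_add_right volume (k : ℝ)).quasiMeasurePreserving.ae (Lp.coeFn_add f g)
      have hp : ∀ᵐ p : ℝ × ℝ ∂volume.restrict unitSquare,
          (f + g : Lp ℂ 2 volume) (p.1 + k) = f (p.1 + k) + g (p.1 + k) :=
        ae_restrict_of_ae (Measure.quasiMeasurePreserving_fst.ae hx)
      filter_upwards [coeFn_zakTerm (f + g) k, coeFn_zakTerm f k, coeFn_zakTerm g k,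
        Lp.coeFn_add (zakTerm f k) (zakTerm g k), hp] with p h1 h2 h3 h4 h5
      rw [h1, h4, Pi.add_apply, h2, h3, h5, add_mul]
    have := (hasSum_zakSquare f).add (hasSum_zakSquare g)
    simp_rw [← hT] at this
    exact (hasSum_zakSquare (f + g)).unique this
  map_smul' c f := by
    have hT : ∀ k : ℤ, zakTerm (c • f) k = c • zakTerm f k := fun k => by
      apply Lp.ext
      have hx : ∀ᵐ x : ℝ, (c • f : Lp ℂ 2 volume) (x + k) = c * f (x + k) :=
        (measurePreserving_add_right volume (k : ℝ)).quasiMeasurePreserving.ae (Lp.coeFn_smul c f)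
      have hp : ∀ᵐ p : ℝ × ℝ ∂volume.restrict unitSquare,
          (c • f : Lp ℂ 2 volume) (p.1 + k) = c * f (p.1 + k) :=
        ae_restrict_of_ae (Measure.quasiMeasurePreserving_fst.ae hx)
      filter_upwards [coeFn_zakTerm (c • f) k, coeFn_zakTerm f k,
        Lp.coeFn_smul c (zakTerm f k), hp] with p h1 h2 h3 h4
      rw [h1, h3, Pi.smul_apply, h2, h4, smul_eq_mul, mul_assoc]
    have := (hasSum_zakSquare f).const_smul c
    simp_rw [← hT] at this
    exact (hasSum_zakSquare (c • f)).unique this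
  norm_map' := norm_zakSquare

theorem zakIsometry_apply (f : Lp ℂ 2 (volume : Measure ℝ)) : zakIsometry f = zakSquare f := rfl

theorem coeFn_timeFreqShift (u η : ℝ) (f : Lp ℂ 2 (volume : Measure ℝ)) :
    timeFreqShift u η f =ᵐ[volume] fun x => unitExp (η * x) * f (x - u) := by
  filter_upwards [(memLp_timeFreqShift u η f).coeFn_toLp] with x hx
  rw [timeFreqShift, hx, exp_eq_unitExp]

theorem norm_timeFreqShift_sub (u η : ℝ) (f g : Lp ℂ 2 (volume : Measure ℝ)) :
    ‖timeFreqShift u η f - timeFreqShift u η g‖ = ‖f - g‖ := by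
  have hfg : ∀ᵐ x : ℝ, (f - g : Lp ℂ 2 volume) (x - u) = f (x - u) - g (x - u) :=
    (measurePreserving_sub_right volume u).quasiMeasurePreserving.ae (Lp.coeFn_sub f g)
  rw [Lp.norm_def, Lp.norm_def,
    ← eLpNorm_comp_measurePreserving (Lp.aestronglyMeasurable (f - g))
      (measurePreserving_sub_right volume u)]
  congr 1
  refine eLpNorm_congr_norm_ae ?_
  filter_upwards [coeFn_timeFreqShift u η f, coeFn_timeFreqShift u η g,
    Lp.coeFn_sub (timeFreqShift u η f) (timeFreqShift u η g), hfg] with x h1 h2 h3 h4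
  rw [h3, Pi.sub_apply, h1, h2, Function.comp_apply, h4, ← mul_sub, norm_mul, norm_unitExp,
    one_mul]

theorem integrable_timeFreqShift (u η : ℝ) {f : Lp ℂ 2 (volume : Measure ℝ)}
    (hf : Integrable f volume) : Integrable (timeFreqShift u η f) volume := by
  refine (hf.comp_sub_right u).mono (Lp.aestronglyMeasurable _) ?_
  filter_upwards [coeFn_timeFreqShift u η f] with x hx
  rw [hx, norm_mul, norm_unitExp, one_mul]

theorem zak_ae_hasSum (f : Lp ℂ 2 (volume : Measure ℝ)) (hf : Integrable f volume) :
    ∀ᵐ z : ℝ × ℝ, HasSum (fun k : ℤ => f (z.1 + k) * unitExp (-(k * z.2))) (zak f z) := by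
  filter_upwards [ae_fract_of_ae_unitSquare (zakSquare_ae_hasSum f hf)] with z hz
  rw [zak_eq]
  have h := hz.mul_left (unitExp (⌊z.1⌋ * z.2))
  rw [← (Equiv.addRight ⌊z.1⌋).hasSum_iff] at h
  refine (congrArg (HasSum · _) (funext fun k => ?_)).mpr h
  simp only [Function.comp_apply, Equiv.coe_addRight, unitExp_neg_mul]
  have e1 : Int.fract z.1 + ((k + ⌊z.1⌋ : ℤ) : ℝ) = z.1 + k := by
    rw [Int.fract]; push_cast; ring
  have e2 : unitExp (⌊z.1⌋ * z.2) * unitExp (-(((k + ⌊z.1⌋ : ℤ) : ℝ) * Int.fract z.2)) =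
      unitExp (-(k * z.2)) := by
    rw [← unitExp_add, ← unitExp_add_int (-(k * z.2)) ((k + ⌊z.1⌋) * ⌊z.2⌋), Int.fract]
    congr 1
    push_cast
    ring
  rw [e1, mul_left_comm, e2]

theorem dense_integrable : Dense {f : Lp ℂ 2 (volume : Measure ℝ) | Integrable f volume} := by
  refine (Lp.simpleFunc.denseRange (E := ℂ) (p := 2) (μ := (volume : Measure ℝ))
    (by norm_num)).mono ?_
  rintro _ ⟨f, rfl⟩
  have h := Lp.simpleFunc.toSimpleFunc_eq_toFun f
  refine Integrable.congr ?_ h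
  exact (SimpleFunc.memLp_iff_integrable (by norm_num) (by norm_num)).1
    ((memLp_congr_ae h).2 (Lp.memLp _))

theorem exists_seq_tendsto_zak {f : ℕ → Lp ℂ 2 (volume : Measure ℝ)}
    {g : Lp ℂ 2 (volume : Measure ℝ)} (h : Tendsto f atTop (𝓝 g)) :
    ∃ s : ℕ → ℕ, StrictMono s ∧
      ∀ᵐ z : ℝ × ℝ, Tendsto (fun n => zak (f (s n)) z) atTop (𝓝 (zak g z)) := by
  have h1 : Tendsto (fun n => zakSquare (f n)) atTop (𝓝 (zakSquare g)) :=
    (zakIsometry.continuous.tendsto g).comp h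
  obtain ⟨s, hs, hlim⟩ := (tendstoInMeasure_of_tendsto_Lp h1).exists_seq_tendsto_ae
  refine ⟨s, hs, ?_⟩
  filter_upwards [ae_fract_of_ae_unitSquare hlim] with z hz
  simp_rw [zak_eq]
  exact hz.const_mul _

/-- The Zak transform turns time-frequency shifts into translations and multiplications by
characters. For integrable functions this is read off the Zak series; the general case follows by
density, passing to almost everywhere convergent subsequences. -/
theorem zak_timeFreqShift (u η : ℝ) (f : Lp ℂ 2 (volume : Measure ℝ)) :
    ∀ᵐ z : ℝ × ℝ, zak (timeFreqShift u η f) z = unitExp (η * z.1) * zak f (z.1 - u, z.2 - η) := by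
  have hL1 : ∀ f : Lp ℂ 2 (volume : Measure ℝ), Integrable f volume →
      ∀ᵐ z : ℝ × ℝ, zak (timeFreqShift u η f) z =
        unitExp (η * z.1) * zak f (z.1 - u, z.2 - η) := by
    intro f hf
    have hc : ∀ᵐ x : ℝ, ∀ k : ℤ, timeFreqShift u η f (x + k) =
        unitExp (η * (x + k)) * f (x + k - u) := ae_all_iff.2 fun k =>
      (measurePreserving_add_right volume (k : ℝ)).quasiMeasurePreserving.ae
        (coeFn_timeFreqShift u η f)
    have h2 : ∀ᵐ z : ℝ × ℝ, HasSum (fun k : ℤ => f (z.1 - u + k) * unitExp (-(k * (z.2 - η))))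
        (zak f (z.1 - u, z.2 - η)) :=
      (measurePreserving_sub_right volume (u, η)).quasiMeasurePreserving.ae (zak_ae_hasSum f hf)
    filter_upwards [zak_ae_hasSum _ (integrable_timeFreqShift u η hf), h2,
      Measure.quasiMeasurePreserving_fst.ae hc] with z ha hb hk
    refine ha.unique ?_
    refine (congrArg (HasSum · _) (funext fun k => ?_)).mpr (hb.mul_left (unitExp (η * z.1)))
    rw [hk, show z.1 + k - u = z.1 - u + k by ring]
    have e : unitExp (η * (z.1 + k)) * unitExp (-(k * z.2)) =
        unitExp (η * z.1) * unitExp (-(k * (z.2 - η))) := by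
      rw [← unitExp_add, ← unitExp_add]
      congr 1
      ring
    linear_combination f (z.1 - u + k) * e
  obtain ⟨F, hF, hFf⟩ := mem_closure_iff_seq_limit.1 (dense_integrable f)
  obtain ⟨s, hs, hlim⟩ := exists_seq_tendsto_zak hFf
  have hFs : Tendsto (fun n => timeFreqShift u η (F (s n))) atTop (𝓝 (timeFreqShift u η f)) := by
    rw [tendsto_iff_norm_sub_tendsto_zero]
    simp_rw [norm_timeFreqShift_sub]
    exact (tendsto_iff_norm_sub_tendsto_zero.1 hFf).comp hs.tendsto_atTop
  obtain ⟨t, ht, hlim'⟩ := exists_seq_tendsto_zak hFs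
  have hn := ae_all_iff.2 fun n => hL1 (F (s (t n))) (hF _)
  have hlim2 : ∀ᵐ z : ℝ × ℝ, Tendsto (fun n => zak (F (s n)) (z.1 - u, z.2 - η)) atTop
      (𝓝 (zak f (z.1 - u, z.2 - η))) :=
    (measurePreserving_sub_right volume (u, η)).quasiMeasurePreserving.ae hlim
  filter_upwards [hn, hlim', hlim2] with z h1 h2 h3
  simp_rw [h1] at h2
  exact tendsto_nhds_unique h2 ((h3.comp ht.tendsto_atTop).const_mul _)

/-! ### Testing weights against trigonometric polynomials -/

/-- The trigonometric polynomial `∑ₖ pₖ e^{2πiNkx}`, of period `1/N`. -/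
noncomputable def trigPoly (N : ℕ) (p : ℤ →₀ ℂ) (x : ℝ) : ℂ :=
  p.sum fun k z => z * unitExp (N * k * x)

@[fun_prop]
theorem continuous_trigPoly (N : ℕ) (p : ℤ →₀ ℂ) : Continuous (trigPoly N p) := by
  unfold trigPoly Finsupp.sum
  fun_prop

@[fun_prop]
theorem measurable_trigPoly (N : ℕ) (p : ℤ →₀ ℂ) : Measurable (trigPoly N p) :=
  (continuous_trigPoly N p).measurable

theorem trigPoly_add_div {N : ℕ} (hN : 0 < N) (p : ℤ →₀ ℂ) (x : ℝ) (r : ℕ) :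
    trigPoly N p (x + r * (1 / N)) = trigPoly N p x := by
  have hN' : (N : ℝ) ≠ 0 := by exact_mod_cast hN.ne'
  unfold trigPoly
  refine Finsupp.sum_congr fun k _ => ?_
  rw [← unitExp_add_int (N * k * x) (k * r)]
  congr 2
  push_cast
  field_simp

theorem integral_unitExp_int (m : ℤ) :
    ∫ x in (0 : ℝ)..1, unitExp (m * x) = if m = 0 then 1 else 0 := by
  split_ifs with h
  · subst h
    simp [show unitExp 0 = 1 by simpa using unitExp_int 0]
  · have hm : (2 * Real.pi * Complex.I * m : ℂ) ≠ 0 :=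
      mul_ne_zero Complex.two_pi_I_ne_zero (by exact_mod_cast h)
    have e : ∀ x : ℝ, unitExp (m * x) = Complex.exp (2 * Real.pi * Complex.I * m * x) := fun x => by
      rw [unitExp]; push_cast; ring_nf
    simp_rw [e]
    rw [integral_exp_mul_complex hm]
    have := unitExp_int m
    rw [unitExp] at this
    push_cast at this
    simp [this]

/-- Parseval's identity for trigonometric polynomials. -/
theorem integral_norm_sq_trigPoly {N : ℕ} (hN : 0 < N) (p : ℤ →₀ ℂ) :
    ∫ x in (0 : ℝ)..1, ‖trigPoly N p x‖ ^ 2 = p.sum fun _ z => ‖z‖ ^ 2 := by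
  have hconj : ∀ t, (starRingEnd ℂ) (unitExp t) = unitExp (-t) := fun t => by
    rw [unitExp, unitExp, ← Complex.exp_conj]
    congr 1
    simp [Complex.conj_ofNat]
  have h1 : ∀ x, ((‖trigPoly N p x‖ ^ 2 : ℝ) : ℂ) = ∑ k ∈ p.support, ∑ l ∈ p.support,
      (p k * (starRingEnd ℂ) (p l)) * unitExp ((N * (k - l) : ℤ) * x) := by
    intro x
    rw [Complex.ofReal_pow, ← Complex.mul_conj', trigPoly, Finsupp.sum, map_sum, Finset.sum_mul_sum]
    refine Finset.sum_congr rfl fun k _ => Finset.sum_congr rfl fun l _ => ?_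
    rw [map_mul, hconj, mul_mul_mul_comm, ← unitExp_add]
    congr 2
    push_cast
    ring
  have h2 : ((∫ x in (0 : ℝ)..1, ‖trigPoly N p x‖ ^ 2 : ℝ) : ℂ) =
      ((p.sum fun _ z => ‖z‖ ^ 2 : ℝ) : ℂ) := by
    rw [← intervalIntegral.integral_ofReal]
    simp_rw [h1]
    rw [intervalIntegral.integral_finsetSum
        fun k _ => Continuous.intervalIntegrable (by fun_prop) _ _,
      Finsupp.sum, Complex.ofReal_sum]
    refine Finset.sum_congr rfl fun k hk => ?_
    rw [intervalIntegral.integral_finsetSum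
      fun l _ => Continuous.intervalIntegrable (by fun_prop) _ _]
    simp_rw [intervalIntegral.integral_const_mul, integral_unitExp_int]
    rw [Finset.sum_eq_single_of_mem k hk]
    · simp [Complex.mul_conj']
    · intro l _ hlk
      have : (N : ℤ) * (k - l) ≠ 0 :=
        mul_ne_zero (by exact_mod_cast hN.ne') (sub_ne_zero.2 hlk.symm)
      rw [if_neg this, mul_zero]
  exact_mod_cast h2

/-- Indicators of intervals are bounded pointwise limits of trigonometric polynomials on a period:
approximate the indicator of a closed subset of the circle by continuous functions, and these
uniformly by trigonometric polynomials. -/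
theorem exists_trigPoly_tendsto_indicator {N : ℕ} (hN : 0 < N) {a b : ℝ} (ha : 0 < a)
    (hb : b < 1 / N) : ∃ p : ℕ → ℤ →₀ ℂ, (∀ n x, ‖trigPoly N (p n) x‖ ≤ 2) ∧
      ∀ x ∈ Ioc (0 : ℝ) (1 / N), Tendsto (fun n => trigPoly N (p n) x) atTop
        (𝓝 ((Icc a b).indicator (fun _ => 1) x)) := by
  have hN' : (0 : ℝ) < N := by exact_mod_cast hN
  set T : ℝ := 1 / N with hT
  have : Fact (0 < T) := ⟨by positivity⟩
  set E : Set (AddCircle T) := (fun x : ℝ => (x : AddCircle T)) '' Icc a b with hE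
  have hEc : IsClosed E := (isCompact_Icc.image (AddCircle.continuous_mk' T)).isClosed
  have hmem : ∀ x ∈ Ioc (0 : ℝ) T, ((x : AddCircle T) ∈ E ↔ x ∈ Icc a b) := by
    intro x hx
    refine ⟨?_, fun h => ⟨x, h, rfl⟩⟩
    rintro ⟨y, hy, hxy⟩
    have hy' : y ∈ Ioc (0 : ℝ) (0 + T) := ⟨ha.trans_le hy.1, by linarith [hy.2]⟩
    have hx' : x ∈ Ioc (0 : ℝ) (0 + T) := by simpa using hx
    have := (AddCircle.coe_eq_coe_iff_of_mem_Ioc hy' hx').1 hxy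
    rwa [← this]
  have hδ : ∀ n : ℕ, (0 : ℝ) < 1 / (n + 1) := fun n => by positivity
  have htend :=
    thickenedIndicator_tendsto_indicator_closure hδ tendsto_one_div_add_atTop_nhds_zero_nat E
  rw [hEc.closure_eq, tendsto_pi_nhds] at htend
  have happ : ∀ n : ℕ, ∃ p : ℤ →₀ ℂ, ∀ x : ℝ,
      ‖trigPoly N p x - (thickenedIndicator (hδ n) E (x : AddCircle T) : ℝ)‖ < 1 / (n + 1) := by
    intro n
    let h : C(AddCircle T, ℂ) := ⟨fun y => ((thickenedIndicator (hδ n) E y : ℝ) : ℂ), by fun_prop⟩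
    have hcl : h ∈ (Submodule.span ℂ (range (@fourier T))).topologicalClosure := by
      rw [span_fourier_closure_eq_top]; trivial
    obtain ⟨q, hq, hqh⟩ := Metric.mem_closure_iff.1 hcl _ (hδ n)
    obtain ⟨p, hp⟩ := Finsupp.mem_span_range_iff_exists_finsupp.1 hq
    refine ⟨p, fun x => ?_⟩
    have hpx : trigPoly N p x = q (x : AddCircle T) := by
      rw [← hp, trigPoly, Finsupp.sum, Finsupp.sum, ContinuousMap.sum_apply]
      refine Finset.sum_congr rfl fun k _ => ?_
      rw [ContinuousMap.smul_apply, fourier_coe_apply, smul_eq_mul, unitExp, hT]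
      congr 2
      push_cast
      field_simp
    rw [hpx, ← dist_eq_norm, dist_comm]
    exact (ContinuousMap.dist_apply_le_dist (f := h) (g := q) (x : AddCircle T)).trans_lt hqh
  choose p hp using happ
  refine ⟨p, fun n x => ?_, fun x hx => ?_⟩
  · have h1 := (hp n x).le
    have h2 : ‖((thickenedIndicator (hδ n) E (x : AddCircle T) : ℝ) : ℂ)‖ ≤ 1 := by
      rw [Complex.norm_real, Real.norm_of_nonneg (NNReal.coe_nonneg _)]
      exact_mod_cast thickenedIndicator_le_one (hδ n) E (x : AddCircle T)
    have h3 : (1 : ℝ) / (n + 1) ≤ 1 := by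
      rw [div_le_one (by positivity)]
      linarith [Nat.cast_nonneg (α := ℝ) n]
    calc ‖trigPoly N (p n) x‖
        = ‖(trigPoly N (p n) x - (thickenedIndicator (hδ n) E (x : AddCircle T) : ℝ)) +
          (thickenedIndicator (hδ n) E (x : AddCircle T) : ℝ)‖ := by rw [sub_add_cancel]
      _ ≤ _ := norm_add_le _ _
      _ ≤ 2 := by linarith
  · have h1 : Tendsto (fun n => ((thickenedIndicator (hδ n) E (x : AddCircle T) : ℝ) : ℂ)) atTop
        (𝓝 ((Icc a b).indicator (fun _ => 1) x)) := by
      have h : Tendsto (fun n => ((thickenedIndicator (hδ n) E (x : AddCircle T) : ℝ) : ℂ)) atTop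
          (𝓝 (((E.indicator (fun _ => 1) (x : AddCircle T) : NNReal) : ℝ) : ℂ)) :=
        (Complex.continuous_ofReal.tendsto _).comp
          ((NNReal.continuous_coe.tendsto _).comp (htend (x : AddCircle T)))
      by_cases hxE : x ∈ Icc a b
      · rw [indicator_of_mem hxE]
        rw [indicator_of_mem ((hmem x hx).2 hxE)] at h
        simpa using h
      · rw [indicator_of_notMem hxE]
        rw [indicator_of_notMem fun h' => hxE ((hmem x hx).1 h')] at h
        simpa using h
    have h2 : Tendsto (fun n => trigPoly N (p n) x -
        (thickenedIndicator (hδ n) E (x : AddCircle T) : ℝ)) atTop (𝓝 0) :=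
      squeeze_zero_norm (fun n => (hp n x).le) tendsto_one_div_add_atTop_nhds_zero_nat
    simpa using h2.add h1

/-- Two weights on the cell `(0, 1/N]²` that compare after integration against
`|p(x)|² |q(ω)|²`, for all trigonometric polynomials `p` and `q`, compare almost everywhere. -/
theorem ae_le_of_lintegral_trigPoly_le {N : ℕ} (hN : 0 < N) {W V : ℝ × ℝ → ENNReal}
    (hW : Measurable W) (hV : Measurable V)
    (iW : ∫⁻ z in Ioc (0 : ℝ) (1 / N) ×ˢ Ioc (0 : ℝ) (1 / N), W z ≠ ⊤)
    (iV : ∫⁻ z in Ioc (0 : ℝ) (1 / N) ×ˢ Ioc (0 : ℝ) (1 / N), V z ≠ ⊤)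
    (h : ∀ p q : ℤ →₀ ℂ,
      ∫⁻ z in Ioc (0 : ℝ) (1 / N) ×ˢ Ioc (0 : ℝ) (1 / N),
        ‖trigPoly N p z.1 * trigPoly N q z.2‖ₑ ^ 2 * W z ≤
      ∫⁻ z in Ioc (0 : ℝ) (1 / N) ×ˢ Ioc (0 : ℝ) (1 / N),
        ‖trigPoly N p z.1 * trigPoly N q z.2‖ₑ ^ 2 * V z) :
    ∀ᵐ z, z ∈ Ioc (0 : ℝ) (1 / N) ×ˢ Ioc (0 : ℝ) (1 / N) → W z ≤ V z := by
  set S : Set (ℝ × ℝ) := Ioc (0 : ℝ) (1 / N) ×ˢ Ioc (0 : ℝ) (1 / N) with hS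
  have mS : MeasurableSet S := measurableSet_Ioc.prod measurableSet_Ioc
  have hrect : ∀ a b c d : ℝ, 0 < a → b < 1 / N → 0 < c → d < 1 / N →
      ∫⁻ z in Icc a b ×ˢ Icc c d, W z ≤ ∫⁻ z in Icc a b ×ˢ Icc c d, V z := by
    intro a b c d ha hb hc hd
    obtain ⟨p, hp, hpl⟩ := exists_trigPoly_tendsto_indicator hN ha hb
    obtain ⟨q, hq, hql⟩ := exists_trigPoly_tendsto_indicator hN hc hd
    have mR : MeasurableSet (Icc a b ×ˢ Icc c d : Set (ℝ × ℝ)) :=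
      measurableSet_Icc.prod measurableSet_Icc
    have hRS : (Icc a b ×ˢ Icc c d : Set (ℝ × ℝ)) ⊆ S :=
      Set.prod_mono (fun x hx => ⟨ha.trans_le hx.1, hx.2.trans hb.le⟩)
        fun x hx => ⟨hc.trans_le hx.1, hx.2.trans hd.le⟩
    have key : ∀ U : ℝ × ℝ → ENNReal, Measurable U → ∫⁻ z in S, U z ≠ ⊤ →
        Tendsto (fun n => ∫⁻ z in S, ‖trigPoly N (p n) z.1 * trigPoly N (q n) z.2‖ₑ ^ 2 * U z)
          atTop (𝓝 (∫⁻ z in Icc a b ×ˢ Icc c d, U z)) := by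
      intro U mU iU
      have e : ∫⁻ z in Icc a b ×ˢ Icc c d, U z =
          ∫⁻ z in S, ‖(Icc a b).indicator (fun _ => (1 : ℂ)) z.1 *
            (Icc c d).indicator (fun _ => (1 : ℂ)) z.2‖ₑ ^ 2 * U z := by
        rw [← inter_eq_self_of_subset_left hRS, ← Measure.restrict_restrict mR,
          ← lintegral_indicator mR]
        refine lintegral_congr fun z => ?_
        by_cases h1 : z.1 ∈ Icc a b <;> by_cases h2 : z.2 ∈ Icc c d
        · rw [indicator_of_mem (show z ∈ Icc a b ×ˢ Icc c d from ⟨h1, h2⟩), indicator_of_mem h1,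
            indicator_of_mem h2]
          simp
        all_goals
          rw [indicator_of_notMem (s := Icc a b ×ˢ Icc c d) fun h => by
            first | exact h1 h.1 | exact h2 h.2]
          simp [h1, h2]
      rw [e]
      refine tendsto_lintegral_of_dominated_convergence (fun z => 16 * U z)
        (fun n => by fun_prop) (fun n => ae_of_all _ fun z => ?_) ?_ ?_
      · refine mul_le_mul_left ?_ (U z)
        have h1 : ‖trigPoly N (p n) z.1 * trigPoly N (q n) z.2‖ₑ ≤ 4 := by
          rw [← ofReal_norm, norm_mul, show (4 : ENNReal) = ENNReal.ofReal (2 * 2) by norm_num]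
          refine ENNReal.ofReal_le_ofReal ?_
          gcongr
          · exact hp n z.1
          · exact hq n z.2
        calc _ ≤ (4 : ENNReal) ^ 2 := by gcongr
          _ = 16 := by norm_num
      · rw [lintegral_const_mul _ mU]
        exact ENNReal.mul_ne_top (by norm_num) iU
      · filter_upwards [ae_restrict_mem mS, ae_lt_top mU iU] with z hz hzU
        refine ENNReal.Tendsto.mul_const ?_ (Or.inr hzU.ne)
        exact ((ENNReal.continuous_pow 2).tendsto _).comp
          ((continuous_enorm.tendsto _).comp ((hpl _ hz.1).mul (hql _ hz.2)))
    exact le_of_tendsto_of_tendsto' (key W hW iW) (key V hV iV) fun n => h (p n) (q n)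
  have hleb : ∀ U : ℝ × ℝ → ENNReal, Measurable U → ∫⁻ z in S, U z ≠ ⊤ → ∀ᵐ z, z ∈ interior S →
      Tendsto (fun r => (∫⁻ y in Metric.closedBall z r, U y) / volume (Metric.closedBall z r))
        (𝓝[>] 0) (𝓝 (U z)) := by
    intro U mU iU
    have iU' : ∫⁻ z, S.indicator U z ≠ ⊤ := by rwa [lintegral_indicator mS]
    filter_upwards [(Besicovitch.vitaliFamily (volume : Measure (ℝ × ℝ))).ae_tendsto_lintegral_div
      (mU.indicator mS).aemeasurable iU'] with z hz hzS
    have h1 := hz.comp (Besicovitch.tendsto_filterAt volume z)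
    rw [indicator_of_mem (interior_subset hzS)] at h1
    refine h1.congr' ?_
    obtain ⟨ε, hε, hεS⟩ := Metric.mem_nhds_iff.1 (mem_interior_iff_mem_nhds.1 hzS)
    filter_upwards [Ioo_mem_nhdsGT hε] with r hr
    simp only [Function.comp_apply]
    congr 1
    refine setLIntegral_congr_fun Metric.isClosed_closedBall.measurableSet fun y hy => ?_
    exact indicator_of_mem (hεS (Metric.closedBall_subset_ball hr.2 hy)) U
  have hfr : ∀ᵐ z, z ∈ S → z ∈ interior S := by
    have h1 : ∀ᵐ z : ℝ × ℝ, z.1 ≠ 1 / N :=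
      Measure.quasiMeasurePreserving_fst.ae (Measure.ae_ne volume _)
    have h2 : ∀ᵐ z : ℝ × ℝ, z.2 ≠ 1 / N :=
      Measure.quasiMeasurePreserving_snd.ae (Measure.ae_ne volume _)
    filter_upwards [h1, h2] with z ha hb hz
    rw [hS, interior_prod_eq, interior_Ioc]
    exact ⟨⟨hz.1.1, lt_of_le_of_ne hz.1.2 ha⟩, hz.2.1, lt_of_le_of_ne hz.2.2 hb⟩
  filter_upwards [hleb W hW iW, hleb V hV iV, hfr] with z hzW hzV hzi hz
  refine le_of_tendsto_of_tendsto (hzW (hzi hz)) (hzV (hzi hz)) ?_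
  have hzI := hzi hz
  rw [hS, interior_prod_eq, interior_Ioc] at hzI
  obtain ⟨ε, hε, hεS⟩ := Metric.mem_nhds_iff.1 ((isOpen_Ioo.prod isOpen_Ioo).mem_nhds hzI)
  filter_upwards [Ioo_mem_nhdsGT hε] with r hr
  refine ENNReal.div_le_div_right ?_ _
  have hb : Metric.closedBall z r = Icc (z.1 - r) (z.1 + r) ×ˢ Icc (z.2 - r) (z.2 + r) := by
    rw [← Real.closedBall_eq_Icc, ← Real.closedBall_eq_Icc, closedBall_prod_same]
  have hlo : (z.1 - r, z.2 - r) ∈ Metric.closedBall z r := by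
    rw [hb]; exact ⟨⟨le_rfl, by linarith [hr.1]⟩, le_rfl, by linarith [hr.1]⟩
  have hhi : (z.1 + r, z.2 + r) ∈ Metric.closedBall z r := by
    rw [hb]; exact ⟨⟨by linarith [hr.1], le_rfl⟩, by linarith [hr.1], le_rfl⟩
  have hlo' := hεS (Metric.closedBall_subset_ball hr.2 hlo)
  have hhi' := hεS (Metric.closedBall_subset_ball hr.2 hhi)
  rw [hb]
  exact hrect _ _ _ _ hlo'.1.1 hhi'.1.2 hlo'.2.1 hhi'.2.2

/-! ### Zak transforms of the Gabor system and folding to a cell -/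

theorem IsRieszBasis.exists_bounds {ι H : Type*} [NormedAddCommGroup H] [InnerProductSpace ℂ H]
    {f : ι → H} (hf : IsRieszBasis f) : ∃ α β : ℝ, 0 < α ∧ 0 < β ∧
      ∀ {κ : Type} (φ : κ → ι), Function.Injective φ → ∀ (s : Finset κ) (d : κ → ℂ),
        α * ∑ i ∈ s, ‖d i‖ ^ 2 ≤ ‖∑ i ∈ s, d i • f (φ i)‖ ^ 2 ∧
          ‖∑ i ∈ s, d i • f (φ i)‖ ^ 2 ≤ β * ∑ i ∈ s, ‖d i‖ ^ 2 := by
  classical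
  obtain ⟨-, α, β, hα, hβ, h⟩ := hf
  refine ⟨α, β, hα, hβ, fun {κ} φ hφ s d => ?_⟩
  set c : κ →₀ ℂ := Finsupp.onFinset s (fun i => if i ∈ s then d i else 0)
    fun i hi => by by_contra h; simp [h] at hi
  have hcd : ∀ i ∈ s, c i = d i := fun i hi => if_pos hi
  have h1 := h (Finsupp.embDomain ⟨φ, hφ⟩ c)
  rw [Finsupp.sum_embDomain, Finsupp.sum_embDomain,
    Finsupp.sum_of_support_subset c (s := s) Finsupp.support_onFinset_subset _ (by simp),
    Finsupp.sum_of_support_subset c (s := s) Finsupp.support_onFinset_subset _ (by simp)] at h1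
  have e1 : ∑ i ∈ s, ‖d i‖ ^ 2 = ∑ i ∈ s, ‖c i‖ ^ 2 :=
    Finset.sum_congr rfl fun i hi => by rw [hcd i hi]
  have e2 : ∑ i ∈ s, d i • f (φ i) = ∑ i ∈ s, c i • f (φ i) :=
    Finset.sum_congr rfl fun i hi => by rw [hcd i hi]
  rw [e1, e2]
  exact h1

/-- The Zak transform of the time-frequency shift of `g` by the lattice vector `p = (a, b)`, in the
normal form `e^{2πiax} Zg(x - b, ω - a)`. -/
noncomputable def gaborZak (g : Lp ℂ 2 (volume : Measure ℝ)) (p : Fin 2 → ℝ) (z : ℝ × ℝ) : ℂ :=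
  unitExp (p 0 * z.1) * zak g (z.1 - p 1, z.2 - p 0)

@[fun_prop]
theorem measurable_gaborZak (g : Lp ℂ 2 (volume : Measure ℝ)) (p : Fin 2 → ℝ) :
    Measurable (gaborZak g p) := by
  unfold gaborZak
  fun_prop

theorem gaborZak_add_one_fst (g : Lp ℂ 2 (volume : Measure ℝ)) (p : Fin 2 → ℝ) (x w : ℝ) :
    gaborZak g p (x + 1, w) = unitExp w * gaborZak g p (x, w) := by
  have h := zak_add_intCast g (x - p 1) (w - p 0) 1 0
  simp only [Int.cast_one, Int.cast_zero, add_zero, one_mul] at h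
  have e : unitExp (p 0 * (x + 1)) * unitExp (w - p 0) = unitExp w * unitExp (p 0 * x) := by
    rw [← unitExp_add, ← unitExp_add]
    congr 1
    ring
  simp only [gaborZak]
  rw [show x + 1 - p 1 = x - p 1 + 1 by ring, h]
  linear_combination zak g (x - p 1, w - p 0) * e

theorem gaborZak_add_one_snd (g : Lp ℂ 2 (volume : Measure ℝ)) (p : Fin 2 → ℝ) (x w : ℝ) :
    gaborZak g p (x, w + 1) = gaborZak g p (x, w) := by
  have h := zak_add_intCast g (x - p 1) (w - p 0) 0 1
  have e0 : unitExp 0 = 1 := by simpa using unitExp_int 0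
  simp only [Int.cast_one, Int.cast_zero, add_zero, zero_mul, e0, one_mul] at h
  simp only [gaborZak]
  rw [show w + 1 - p 0 = w - p 0 + 1 by ring, h]

/-- Shifting the lattice vector by `N(k, -l)` multiplies the Zak transform by a character of
period `1/N`; integrality of `Na` removes the phase. -/
theorem gaborZak_add_mul (g : Lp ℂ 2 (volume : Measure ℝ)) {N : ℕ} {p : Fin 2 → ℝ}
    (hp : ∃ m : ℤ, N * p 0 = m) (k l : ℤ) (z : ℝ × ℝ) :
    gaborZak g (fun i => p i + N * ((![k, -l] i : ℤ) : ℝ)) z =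
      unitExp (N * k * z.1) * unitExp (N * l * z.2) * gaborZak g p z := by
  obtain ⟨m, hm⟩ := hp
  simp only [gaborZak, Matrix.cons_val_zero, Matrix.cons_val_one]
  have h := zak_add_intCast g (z.1 - p 1) (z.2 - p 0) (N * l) (-(N * k))
  push_cast at h ⊢
  rw [show z.1 - (p 1 + N * -(l : ℝ)) = z.1 - p 1 + N * l by ring,
    show z.2 - (p 0 + N * (k : ℝ)) = z.2 - p 0 + -(N * k) by ring, h]
  have e : unitExp ((p 0 + N * k) * z.1) * unitExp (N * l * (z.2 - p 0)) =
      unitExp (N * k * z.1) * unitExp (N * l * z.2) * unitExp (p 0 * z.1) := by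
    rw [← unitExp_add, ← unitExp_add, ← unitExp_add, ← unitExp_add_int _ (l * m)]
    congr 1
    push_cast
    linear_combination (l : ℝ) * (-hm)
  linear_combination zak g (z.1 - p 1, z.2 - p 0) * e

theorem zakSquare_timeFreqShift (g : Lp ℂ 2 (volume : Measure ℝ)) (p : Fin 2 → ℝ) :
    zakSquare (timeFreqShift (p 1) (p 0) g) =ᵐ[(volume : Measure (ℝ × ℝ)).restrict unitSquare]
      gaborZak g p := by
  filter_upwards [zak_ae_eq_zakSquare (timeFreqShift (p 1) (p 0) g),
    ae_restrict_of_ae (zak_timeFreqShift (p 1) (p 0) g)] with z h1 h2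
  rw [← h1, h2, gaborZak]

theorem lintegral_Ioc_nat_mul {f : ℝ → ENNReal} (hf : Measurable f) {t : ℝ} (ht : 0 < t) (m : ℕ) :
    ∫⁻ x in Ioc 0 (m * t), f x = ∫⁻ x in Ioc 0 t, ∑ r ∈ Finset.range m, f (x + r * t) := by
  induction m with
  | zero => simp
  | succ m ih =>
    simp_rw [Finset.sum_range_succ]
    rw [lintegral_add_left (by fun_prop), ← ih]
    have hu : Ioc (0 : ℝ) ((m + 1 : ℕ) * t) = Ioc 0 (m * t) ∪ Ioc (m * t) ((m + 1 : ℕ) * t) := by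
      rw [Ioc_union_Ioc_eq_Ioc (by positivity)]
      push_cast
      nlinarith
    rw [hu, lintegral_union measurableSet_Ioc (Ioc_disjoint_Ioc_of_le le_rfl)]
    congr 1
    have :=
      (measurePreserving_add_right (volume : Measure ℝ) (m * t)).setLIntegral_comp_preimage_emb
      (MeasurableEquiv.addRight (m * t)).measurableEmbedding f (Ioc (m * t) ((m + 1 : ℕ) * t))
    rw [← this]
    congr 2
    ext x
    simp only [mem_preimage, mem_Ioc]
    push_cast
    constructor <;> rintro ⟨_, _⟩ <;> constructor <;> linarith

/-- The sum of the values of `Φ` at the `N²` points `z + (r/N, s/N)`, `0 ≤ r, s < N`. -/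
noncomputable def cellSum (N : ℕ) (Φ : ℝ × ℝ → ENNReal) (z : ℝ × ℝ) : ENNReal :=
  ∑ r ∈ Finset.range N, ∑ s ∈ Finset.range N, Φ (z.1 + r * (1 / N), z.2 + s * (1 / N))

@[fun_prop]
theorem measurable_cellSum (N : ℕ) {Φ : ℝ × ℝ → ENNReal} (hΦ : Measurable Φ) :
    Measurable (cellSum N Φ) := by
  unfold cellSum
  fun_prop

/-- The integral over the unit square folds to the cell `(0, 1/N]²`. -/
theorem lintegral_unitSquare {N : ℕ} (hN : 0 < N) {Φ : ℝ × ℝ → ENNReal} (hΦ : Measurable Φ) :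
    ∫⁻ z in unitSquare, Φ z =
      ∫⁻ z in Ioc (0 : ℝ) (1 / N) ×ˢ Ioc (0 : ℝ) (1 / N), cellSum N Φ z := by
  have hN' : (0 : ℝ) < N := by exact_mod_cast hN
  have ht : (0 : ℝ) < 1 / N := by positivity
  have h1 : (1 : ℝ) = N * (1 / N) := by field_simp
  have key : ∀ f : ℝ → ENNReal, Measurable f → ∫⁻ x in Icc (0 : ℝ) 1, f x =
      ∫⁻ x in Ioc (0 : ℝ) (1 / N), ∑ r ∈ Finset.range N, f (x + r * (1 / N)) := fun f hf => by
    rw [restrict_Ioc_eq_restrict_Icc.symm, ← lintegral_Ioc_nat_mul hf ht, ← h1]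
  rw [restrict_unitSquare, lintegral_prod _ hΦ.aemeasurable, Measure.volume_eq_prod,
    ← Measure.prod_restrict, lintegral_prod _ (measurable_cellSum N hΦ).aemeasurable,
    key _ hΦ.lintegral_prod_right']
  refine lintegral_congr fun x => ?_
  simp only [cellSum]
  rw [lintegral_finsetSum _ fun r _ => by fun_prop]
  exact Finset.sum_congr rfl fun r _ => key _ (by fun_prop)

theorem periodic_sum_range {M : Type*} [AddCommMonoid M] {φ : ℝ → M} {N : ℕ} (hN : 0 < N) {t : ℝ}
    (hφ : Function.Periodic φ (N * t)) :
    Function.Periodic (fun x => ∑ r ∈ Finset.range N, φ (x + r * t)) t := by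
  intro x
  obtain ⟨m, rfl⟩ := Nat.exists_eq_succ_of_ne_zero hN.ne'
  simp only
  rw [Finset.sum_range_succ, Finset.sum_range_succ' (fun r : ℕ => φ (x + r * t))]
  congr 1
  · refine Finset.sum_congr rfl fun r _ => ?_
    congr 1
    push_cast
    ring
  · rw [← hφ (x + (0 : ℕ) * t)]
    congr 1
    push_cast
    ring

theorem ae_of_ae_cell {N : ℕ} (hN : 0 < N) {Φ : ℝ × ℝ → ENNReal}
    (h1 : ∀ x w, Φ (x + 1, w) = Φ (x, w)) (h2 : ∀ x w, Φ (x, w + 1) = Φ (x, w))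
    {Q : ENNReal → Prop}
    (h : ∀ᵐ z, z ∈ Ioc (0 : ℝ) (1 / N) ×ˢ Ioc (0 : ℝ) (1 / N) → Q (cellSum N Φ z)) :
    ∀ᵐ z, Q (cellSum N Φ z) := by
  have hN' : (0 : ℝ) < N := by exact_mod_cast hN
  set t : ℝ := 1 / N with ht
  have ht0 : 0 < t := by positivity
  have hNt : N * t = 1 := by rw [ht]; field_simp
  have p1 : ∀ w, Function.Periodic (fun x => cellSum N Φ (x, w)) t := fun w => by
    refine periodic_sum_range (φ := fun x => ∑ s ∈ Finset.range N, Φ (x, w + s * t)) hN ?_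
    rw [hNt]
    intro x
    simp only [h1]
  have p2 : ∀ x, Function.Periodic (fun w => cellSum N Φ (x, w)) t := fun x => by
    have : ∀ w, cellSum N Φ (x, w) =
        ∑ s ∈ Finset.range N, ∑ r ∈ Finset.range N, Φ (x + r * t, w + s * t) :=
      fun w => Finset.sum_comm
    simp_rw [this]
    refine periodic_sum_range (φ := fun w => ∑ r ∈ Finset.range N, Φ (x + r * t, w)) hN ?_
    rw [hNt]
    intro w
    simp only [h2]
  have h3 : ∀ᵐ z : ℝ × ℝ, ∀ k : ℤ × ℤ, z - (k.1 • t, k.2 • t) ∈ Ioc (0 : ℝ) t ×ˢ Ioc (0 : ℝ) t →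
      Q (cellSum N Φ (z - (k.1 • t, k.2 • t))) := ae_all_iff.2 fun k =>
    (measurePreserving_sub_right volume (k.1 • t, k.2 • t)).quasiMeasurePreserving.ae h
  filter_upwards [h3] with z hz
  obtain ⟨k, hk, -⟩ := existsUnique_sub_zsmul_mem_Ioc ht0 z.1 0
  obtain ⟨l, hl, -⟩ := existsUnique_sub_zsmul_mem_Ioc ht0 z.2 0
  simp only [zero_add] at hk hl
  have := hz (k, l) ⟨hk, hl⟩
  have e : cellSum N Φ (z - (k • t, l • t)) = cellSum N Φ z :=
    ((p1 (z.2 - l • t)).sub_zsmul_eq k (x := z.1)).trans ((p2 z.1).sub_zsmul_eq l (x := z.2))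
  rwa [e] at this

theorem ofReal_norm_sq_Lp {X : Type*} [MeasurableSpace X] {μ : Measure X} (f : Lp ℂ 2 μ) :
    ENNReal.ofReal (‖f‖ ^ 2) = ∫⁻ x, ‖f x‖ₑ ^ 2 ∂μ := by
  rw [ENNReal.ofReal_pow (norm_nonneg _), ofReal_norm, Lp.enorm_def]
  have := eLpNorm_nnreal_pow_eq_lintegral (μ := μ) (f := f) (p := 2) two_ne_zero
  simpa using this

theorem lintegral_enorm_sq_trigPoly {N : ℕ} (hN : 0 < N) (p : ℤ →₀ ℂ) :
    ∫⁻ x in Icc (0 : ℝ) 1, ‖trigPoly N p x‖ₑ ^ 2 =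
      ENNReal.ofReal (p.sum fun _ z => ‖z‖ ^ 2) := by
  rw [← integral_norm_sq_trigPoly hN, intervalIntegral.integral_of_le zero_le_one,
    ← integral_Icc_eq_integral_Ioc, ofReal_integral_eq_lintegral_ofReal]
  · refine lintegral_congr fun x => ?_
    rw [ENNReal.ofReal_pow (norm_nonneg _), ofReal_norm]
  · exact Continuous.integrableOn_Icc (by fun_prop)
  · exact ae_of_all _ fun x => by positivity

/-! ### Localization of the Riesz inequalities -/

/-- The Riesz bounds for the combinations `∑ vⱼ pₖ qₗ π(λⱼ + N(k, -l)) g`, transported to the unit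
square by the Zak transform. -/
theorem riesz_bounds_trigPoly {g : Lp ℂ 2 (volume : Measure ℝ)} {Λ : Set (Fin 2 → ℝ)}
    (hg : IsRieszBasis (gaborSystem g Λ)) : ∃ α β : ℝ, 0 < α ∧ 0 < β ∧
      ∀ {J : Type} [Fintype J] {N : ℕ} (_ : 0 < N) (lam : J → Fin 2 → ℝ)
        (_ : ∀ j i, ∃ m : ℤ, N * lam j i = m)
        (_ : ∀ j (m : Fin 2 → ℤ), (fun i => lam j i + N * m i) ∈ Λ)
        (_ : Function.Injective fun (p : J × (Fin 2 → ℤ)) i => lam p.1 i + N * (p.2 i : ℝ))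
        (v : J → ℂ) (p q : ℤ →₀ ℂ),
        ENNReal.ofReal (α * ∑ j, ‖v j‖ ^ 2) *
            ∫⁻ z in unitSquare, ‖trigPoly N p z.1 * trigPoly N q z.2‖ₑ ^ 2 ≤
          ∫⁻ z in unitSquare, ‖trigPoly N p z.1 * trigPoly N q z.2‖ₑ ^ 2 *
            ‖∑ j, v j * gaborZak g (lam j) z‖ₑ ^ 2 ∧
        ∫⁻ z in unitSquare, ‖trigPoly N p z.1 * trigPoly N q z.2‖ₑ ^ 2 *
            ‖∑ j, v j * gaborZak g (lam j) z‖ₑ ^ 2 ≤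
          ENNReal.ofReal (β * ∑ j, ‖v j‖ ^ 2) *
            ∫⁻ z in unitSquare, ‖trigPoly N p z.1 * trigPoly N q z.2‖ₑ ^ 2 := by
  obtain ⟨α, β, hα, hβ, h⟩ := hg.exists_bounds
  refine ⟨α, β, hα, hβ, fun {J} _ {N} hN lam hlam hmem hinj v p q => ?_⟩
  set φ : J × ℤ × ℤ → Λ := fun i => ⟨_, hmem i.1 ![i.2.1, -i.2.2]⟩ with hφ
  have hφi : Function.Injective φ := by
    rintro ⟨j, k, l⟩ ⟨j', k', l'⟩ hi
    have h1 := @hinj (j, ![k, -l]) (j', ![k', -l']) (congrArg Subtype.val hi)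
    simp only [Prod.mk.injEq] at h1
    have h2 := congrFun h1.2 0
    have h3 := congrFun h1.2 1
    simp only [Matrix.cons_val_zero, Matrix.cons_val_one, neg_inj] at h2 h3
    rw [h1.1, h2, h3]
  set s : Finset (J × ℤ × ℤ) := Finset.univ ×ˢ (p.support ×ˢ q.support) with hs
  set d : J × ℤ × ℤ → ℂ := fun i => v i.1 * (p i.2.1 * q i.2.2) with hd
  have hb := h φ hφi s d
  have hsum : ∑ i ∈ s, ‖d i‖ ^ 2 = (∑ j, ‖v j‖ ^ 2) *
      ((p.sum fun _ z => ‖z‖ ^ 2) * q.sum fun _ z => ‖z‖ ^ 2) := by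
    rw [hs, Finset.sum_product, Finset.sum_mul]
    refine Finset.sum_congr rfl fun j _ => ?_
    rw [Finsupp.sum, Finsupp.sum, Finset.sum_mul_sum, ← Finset.sum_product', Finset.mul_sum]
    refine Finset.sum_congr rfl fun i _ => ?_
    rw [hd]
    simp only [norm_mul, mul_pow]
  have hint : ∫⁻ z in unitSquare, ‖trigPoly N p z.1 * trigPoly N q z.2‖ₑ ^ 2 =
      ENNReal.ofReal ((p.sum fun _ z => ‖z‖ ^ 2) * q.sum fun _ z => ‖z‖ ^ 2) := by
    simp_rw [enorm_mul, mul_pow]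
    rw [restrict_unitSquare, lintegral_prod_mul (f := fun x => ‖trigPoly N p x‖ₑ ^ 2)
      (g := fun x => ‖trigPoly N q x‖ₑ ^ 2) (by fun_prop) (by fun_prop),
      lintegral_enorm_sq_trigPoly hN, lintegral_enorm_sq_trigPoly hN,
      ENNReal.ofReal_mul (Finsupp.sum_nonneg fun _ _ => by positivity)]
  have hzak : zakIsometry (∑ i ∈ s, d i • gaborSystem g Λ (φ i))
      =ᵐ[(volume : Measure (ℝ × ℝ)).restrict unitSquare] fun z =>
        trigPoly N p z.1 * trigPoly N q z.2 * ∑ j, v j * gaborZak g (lam j) z := by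
    rw [map_sum]
    simp_rw [map_smul, zakIsometry_apply]
    have h1 : ∀ᵐ z ∂(volume : Measure (ℝ × ℝ)).restrict unitSquare, ∀ i ∈ s,
        (d i • zakSquare (gaborSystem g Λ (φ i)) : Lp ℂ 2 _) z =
          d i * gaborZak g (φ i).1 z := (Finset.eventually_all s).2 fun i _ => by
      filter_upwards [Lp.coeFn_smul (d i) (zakSquare (gaborSystem g Λ (φ i))),
        zakSquare_timeFreqShift g (φ i).1] with z h1 h2
      rw [h1, Pi.smul_apply, smul_eq_mul, ← h2]
      rfl
    filter_upwards [Lp.coeFn_finsetSum s fun i => d i • zakSquare (gaborSystem g Λ (φ i)), h1]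
      with z hz1 hz2
    rw [hz1, Finset.sum_apply, Finset.sum_congr rfl hz2, hs, Finset.sum_product,
      Finset.mul_sum]
    refine Finset.sum_congr rfl fun j _ => ?_
    rw [trigPoly, trigPoly, Finsupp.sum, Finsupp.sum, Finset.sum_mul_sum, ← Finset.sum_product',
      Finset.sum_mul]
    refine Finset.sum_congr rfl fun i _ => ?_
    simp only [hd, hφ]
    rw [gaborZak_add_mul g (hlam j 0)]
    ring
  have hnorm : ENNReal.ofReal (‖∑ i ∈ s, d i • gaborSystem g Λ (φ i)‖ ^ 2) =
      ∫⁻ z in unitSquare, ‖trigPoly N p z.1 * trigPoly N q z.2‖ₑ ^ 2 *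
        ‖∑ j, v j * gaborZak g (lam j) z‖ₑ ^ 2 := by
    rw [← zakIsometry.norm_map, ofReal_norm_sq_Lp]
    refine lintegral_congr_ae ?_
    filter_upwards [hzak] with z hz
    rw [hz, enorm_mul, mul_pow]
  rw [hint, ← hnorm, ← ENNReal.ofReal_mul (by positivity), ← ENNReal.ofReal_mul (by positivity),
    mul_assoc, mul_assoc, ← hsum]
  exact ⟨ENNReal.ofReal_le_ofReal hb.1, ENNReal.ofReal_le_ofReal hb.2⟩

/-- The Riesz bounds, localized: the quadratic form of the matrix of values of the Zak transforms
of the coset representatives at the points `z + (r/N, s/N)` is pinched almost everywhere. -/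
theorem ae_bounds_cellSum {g : Lp ℂ 2 (volume : Measure ℝ)} {Λ : Set (Fin 2 → ℝ)}
    (hg : IsRieszBasis (gaborSystem g Λ)) {J : Type} [Fintype J] {N : ℕ} (hN : 0 < N)
    (lam : J → Fin 2 → ℝ) (hlam : ∀ j i, ∃ m : ℤ, N * lam j i = m)
    (hmem : ∀ j (m : Fin 2 → ℤ), (fun i => lam j i + N * m i) ∈ Λ)
    (hinj : Function.Injective fun (p : J × (Fin 2 → ℤ)) i => lam p.1 i + N * (p.2 i : ℝ)) :
    ∃ α β : ℝ, 0 < α ∧ 0 < β ∧ ∀ v : J → ℂ, ∀ᵐ z : ℝ × ℝ,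
      ENNReal.ofReal (α * ∑ j, ‖v j‖ ^ 2) ≤
          cellSum N (fun z => ‖∑ j, v j * gaborZak g (lam j) z‖ₑ ^ 2) z ∧
        cellSum N (fun z => ‖∑ j, v j * gaborZak g (lam j) z‖ₑ ^ 2) z ≤
          ENNReal.ofReal (β * ∑ j, ‖v j‖ ^ 2) := by
  obtain ⟨α, β, hα, hβ, h⟩ := riesz_bounds_trigPoly hg
  have hN' : (0 : ℝ) < N := by exact_mod_cast hN
  have hN2 : ((N : ENNReal) * N) = ENNReal.ofReal (N * N) := by
    rw [ENNReal.ofReal_mul hN'.le, ENNReal.ofReal_natCast]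
  refine ⟨N * N * α, N * N * β, by positivity, by positivity, fun v => ?_⟩
  set Φ : ℝ × ℝ → ENNReal := fun z => ‖∑ j, v j * gaborZak g (lam j) z‖ₑ ^ 2 with hΦ
  have mΦ : Measurable Φ := by fun_prop
  have per1 : ∀ x w, Φ (x + 1, w) = Φ (x, w) := fun x w => by
    simp only [hΦ, gaborZak_add_one_fst, mul_left_comm _ (unitExp w)]
    rw [← Finset.mul_sum, enorm_mul, ← ofReal_norm (unitExp w), norm_unitExp]
    simp
  have per2 : ∀ x w, Φ (x, w + 1) = Φ (x, w) := fun x w => by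
    simp only [hΦ, gaborZak_add_one_snd]
  set S : Set (ℝ × ℝ) := Ioc (0 : ℝ) (1 / N) ×ˢ Ioc (0 : ℝ) (1 / N) with hS
  have hSv : volume S ≠ ⊤ := by
    rw [hS, Measure.volume_eq_prod, Measure.prod_prod, Real.volume_Ioc]
    exact ENNReal.mul_ne_top ENNReal.ofReal_ne_top ENNReal.ofReal_ne_top
  -- `p` and `q` have period `1/N`, so they come out of the sum over the cells
  have hfold : ∀ (p q : ℤ →₀ ℂ) (Ψ : ℝ × ℝ → ENNReal), Measurable Ψ →
      ∫⁻ z in unitSquare, ‖trigPoly N p z.1 * trigPoly N q z.2‖ₑ ^ 2 * Ψ z =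
        ∫⁻ z in S, ‖trigPoly N p z.1 * trigPoly N q z.2‖ₑ ^ 2 * cellSum N Ψ z := by
    intro p q Ψ mΨ
    rw [lintegral_unitSquare hN (by fun_prop)]
    refine lintegral_congr fun z => ?_
    simp only [cellSum, trigPoly_add_div hN, Finset.mul_sum]
  have hone : ∀ z, cellSum N (fun _ => 1) z = N * N := fun z => by simp [cellSum]
  have hlow : ∀ p q : ℤ →₀ ℂ,
      ∫⁻ z in S, ‖trigPoly N p z.1 * trigPoly N q z.2‖ₑ ^ 2 *
          ENNReal.ofReal (N * N * α * ∑ j, ‖v j‖ ^ 2) ≤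
        ∫⁻ z in S, ‖trigPoly N p z.1 * trigPoly N q z.2‖ₑ ^ 2 * cellSum N Φ z := by
    intro p q
    have := (h hN lam hlam hmem hinj v p q).1
    have e := hfold p q (fun _ => 1) measurable_const
    simp only [mul_one, hone] at e
    rw [hfold p q Φ mΦ, e, lintegral_mul_const _ (by fun_prop)] at this
    rw [lintegral_mul_const _ (by fun_prop)]
    refine le_trans (le_of_eq ?_) this
    rw [hN2, mul_left_comm, ← ENNReal.ofReal_mul (by positivity)]
    congr 2
    ring
  have hupp : ∀ p q : ℤ →₀ ℂ,
      ∫⁻ z in S, ‖trigPoly N p z.1 * trigPoly N q z.2‖ₑ ^ 2 * cellSum N Φ z ≤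
        ∫⁻ z in S, ‖trigPoly N p z.1 * trigPoly N q z.2‖ₑ ^ 2 *
          ENNReal.ofReal (N * N * β * ∑ j, ‖v j‖ ^ 2) := by
    intro p q
    have := (h hN lam hlam hmem hinj v p q).2
    have e := hfold p q (fun _ => 1) measurable_const
    simp only [mul_one, hone] at e
    rw [hfold p q Φ mΦ, e, lintegral_mul_const _ (by fun_prop)] at this
    rw [lintegral_mul_const _ (by fun_prop)]
    refine this.trans (le_of_eq ?_)
    rw [hN2, mul_left_comm, ← ENNReal.ofReal_mul (by positivity)]
    congr 2
    ring
  have hc : ∀ c : ℝ, ∫⁻ z in S, ENNReal.ofReal c ≠ ⊤ := fun c => by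
    rw [setLIntegral_const]
    exact ENNReal.mul_ne_top ENNReal.ofReal_ne_top hSv
  have iΦ : ∫⁻ z in S, cellSum N Φ z ≠ ⊤ := by
    have h1 := hupp (Finsupp.single 0 1) (Finsupp.single 0 1)
    have e1 : ∀ x, trigPoly N (Finsupp.single 0 1) x = 1 := fun x => by
      simpa [trigPoly] using unitExp_int 0
    simp only [e1, mul_one, enorm_one, one_pow, one_mul] at h1
    exact ne_top_of_le_ne_top (hc _) h1
  have a1 := ae_le_of_lintegral_trigPoly_le hN measurable_const (measurable_cellSum N mΦ) (hc _) iΦ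
    hlow
  have a2 := ae_le_of_lintegral_trigPoly_le hN (measurable_cellSum N mΦ) measurable_const iΦ (hc _)
    hupp
  exact (ae_of_ae_cell hN per1 per2 (Q := fun t => ENNReal.ofReal _ ≤ t) a1).and
    (ae_of_ae_cell hN per1 per2 (Q := fun t => t ≤ ENNReal.ofReal _) a2)

/-! ### The determinant -/

/-- A square matrix that is bounded below has determinant bounded away from `0`: the entries of the
inverse are bounded, hence so is its determinant. -/
theorem le_norm_det_of_bounded_below {ι : Type*} [Fintype ι] [DecidableEq ι] {κ : ℝ} (hκ : 0 < κ)
    (M : Matrix ι ι ℂ) (h : ∀ v : ι → ℂ, κ * ∑ j, ‖v j‖ ^ 2 ≤ ∑ i, ‖(M.mulVec v) i‖ ^ 2) :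
    ((Fintype.card ι).factorial * (Real.sqrt κ)⁻¹ ^ Fintype.card ι)⁻¹ ≤ ‖M.det‖ := by
  have hdet : M.det ≠ 0 := by
    intro h0
    obtain ⟨v, hv, hMv⟩ := Matrix.exists_mulVec_eq_zero_iff.2 h0
    have h1 := h v
    simp only [hMv, Pi.zero_apply, norm_zero, ne_eq, OfNat.ofNat_ne_zero, not_false_eq_true,
      zero_pow, Finset.sum_const_zero] at h1
    obtain ⟨j, hj⟩ := Function.ne_iff.1 hv
    have h2 : 0 < ∑ j, ‖v j‖ ^ 2 :=
      Finset.sum_pos' (fun _ _ => by positivity)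
        ⟨j, Finset.mem_univ j, pow_pos (norm_pos_iff.2 hj) 2⟩
    nlinarith
  have hu : IsUnit M.det := isUnit_iff_ne_zero.2 hdet
  have hentry : ∀ i j, (NormedField.toAbsoluteValue ℂ) (M⁻¹ i j) ≤ (Real.sqrt κ)⁻¹ := by
    intro i j
    have h1 := h (M⁻¹.mulVec (Pi.single j 1))
    rw [Matrix.mulVec_mulVec, Matrix.mul_nonsing_inv M hu, Matrix.one_mulVec,
      Matrix.mulVec_single_one] at h1
    have h2 : ∑ i, ‖(Pi.single j 1 : ι → ℂ) i‖ ^ 2 = 1 := by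
      rw [Finset.sum_eq_single j (by intro b _ hb; simp [hb]) (by simp)]
      simp
    rw [h2] at h1
    have h3 : ‖M⁻¹ i j‖ ^ 2 ≤ ∑ i, ‖M⁻¹.col j i‖ ^ 2 :=
      Finset.single_le_sum (f := fun i => ‖M⁻¹.col j i‖ ^ 2) (fun _ _ => by positivity)
        (Finset.mem_univ i)
    change ‖M⁻¹ i j‖ ≤ _
    rw [← Real.sqrt_inv]
    refine Real.le_sqrt_of_sq_le ?_
    rw [inv_eq_one_div κ, le_div_iff₀ hκ]
    nlinarith
  have h1 := Matrix.det_le hentry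
  change ‖M⁻¹.det‖ ≤ _ at h1
  rw [Matrix.det_nonsing_inv, Ring.inverse_eq_inv', norm_inv, nsmul_eq_mul] at h1
  exact inv_le_of_inv_le₀ (norm_pos_iff.2 hdet) h1

theorem isBddVMO_gaborZak {g : Lp ℂ 2 (volume : Measure ℝ)} (hg : IsBddVMO (zak g))
    (p : Fin 2 → ℝ) : IsBddVMO (gaborZak g p) := by
  have h1 : IsBddVMO fun z : ℝ × ℝ => unitExp (p 0 * z.1) := by
    refine .of_uniformContinuous (C := 1) ?_ fun z => (norm_unitExp _).le
    refine (LipschitzWith.of_dist_le' (K := 2 * Real.pi * |p 0|) fun z w => ?_).uniformContinuous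
    rw [dist_eq_norm]
    refine (norm_unitExp_sub_le _ _).trans ?_
    rw [← mul_sub, abs_mul, ← mul_assoc]
    gcongr
    rw [← Real.dist_eq, Prod.dist_eq]
    exact le_max_left _ _
  exact h1.mul (hg.translate (-p 1, -p 0))

/-- The matrix of the values of the Zak transforms of `π(λⱼ)g` at the points `z + (r/N, s/N)`. -/
noncomputable def zakMatrix (g : Lp ℂ 2 (volume : Measure ℝ)) {N : ℕ}
    (lam : Fin N × Fin N → Fin 2 → ℝ) (z : ℝ × ℝ) : Matrix (Fin N × Fin N) (Fin N × Fin N) ℂ :=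
  Matrix.of fun i j => gaborZak g (lam j) (z + ((i.1 : ℝ) * (1 / N), (i.2 : ℝ) * (1 / N)))

theorem cellSum_eq_zakMatrix (g : Lp ℂ 2 (volume : Measure ℝ)) {N : ℕ}
    (lam : Fin N × Fin N → Fin 2 → ℝ) (v : Fin N × Fin N → ℂ) (z : ℝ × ℝ) :
    cellSum N (fun z => ‖∑ j, v j * gaborZak g (lam j) z‖ₑ ^ 2) z =
      ENNReal.ofReal (∑ i, ‖((zakMatrix g lam z).mulVec v) i‖ ^ 2) := by
  rw [ENNReal.ofReal_sum_of_nonneg fun _ _ => by positivity, Fintype.sum_prod_type, cellSum,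
    Finset.sum_range]
  refine Finset.sum_congr rfl fun r _ => ?_
  rw [Finset.sum_range]
  refine Finset.sum_congr rfl fun s _ => ?_
  rw [ENNReal.ofReal_pow (norm_nonneg _), ofReal_norm]
  simp only [Matrix.mulVec, dotProduct, zakMatrix, Matrix.of_apply, mul_comm (v _)]
  rfl

/-- The determinant winds `N²` times more often in the second variable after a unit step in the
first, since each of its `N²` rows does so once. -/
theorem det_zakMatrix_add_one_fst (g : Lp ℂ 2 (volume : Measure ℝ)) {N : ℕ}
    (lam : Fin N × Fin N → Fin 2 → ℝ) (x w : ℝ) :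
    (zakMatrix g lam (x + 1, w)).det =
      unitExp (((N * N : ℕ) : ℤ) * w + ∑ i : Fin N × Fin N, (i.2 : ℝ) * (1 / N)) *
        (zakMatrix g lam (x, w)).det := by
  have h : zakMatrix g lam (x + 1, w) = Matrix.of fun i j =>
      unitExp (w + (i.2 : ℝ) * (1 / N)) * zakMatrix g lam (x, w) i j := by
    ext i j
    simp only [zakMatrix, Matrix.of_apply, Prod.mk_add_mk]
    rw [← gaborZak_add_one_fst, add_right_comm]
  rw [h, Matrix.det_mul_column, ← unitExp_sum, Finset.sum_add_distrib]
  simp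

theorem det_zakMatrix_add_one_snd (g : Lp ℂ 2 (volume : Measure ℝ)) {N : ℕ}
    (lam : Fin N × Fin N → Fin 2 → ℝ) (x w : ℝ) :
    (zakMatrix g lam (x, w + 1)).det = (zakMatrix g lam (x, w)).det := by
  congr 1
  ext i j
  simp only [zakMatrix, Matrix.of_apply, Prod.mk_add_mk]
  rw [add_right_comm]
  exact gaborZak_add_one_snd g (lam j) _ _

theorem theorem1p7 (g : Lp ℂ 2 (volume : Measure ℝ)) (A : Matrix.GeneralLinearGroup (Fin 2) ℚ)
    (hA : (A : Matrix (Fin 2) (Fin 2) ℚ).det = 1)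
    (hg : IsRieszBasis (gaborSystem g (latticeOf (A : Matrix (Fin 2) (Fin 2) ℚ)))) :
    ¬ IsVMOLoc (zak g) := by
  intro hV
  obtain ⟨N, lam, hN, hlam, hmem, hinj⟩ := exists_cosets_latticeOf _ hA
  obtain ⟨α, β, hα, hβ, hb⟩ := ae_bounds_cellSum hg hN lam hlam hmem hinj
  have : NeZero N := ⟨hN.ne'⟩
  simp_rw [cellSum_eq_zakMatrix] at hb
  -- the upper bound, for a unit vector, bounds `Zg`
  have hbdd : ∀ᵐ z, ‖zak g z‖ ≤ Real.sqrt β := by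
    set j₀ : Fin N × Fin N := (0, 0)
    have h1 : ∀ᵐ z, ‖gaborZak g (lam j₀) z‖ ≤ Real.sqrt β := by
      filter_upwards [hb (Pi.single j₀ 1)] with z hz
      have h2 : ∑ i, ‖(Pi.single j₀ 1 : Fin N × Fin N → ℂ) i‖ ^ 2 = 1 := by
        rw [Finset.sum_eq_single j₀ (by intro b _ hb; simp [hb]) (by simp)]
        simp
      have h3 := hz.2
      rw [h2, mul_one, ENNReal.ofReal_le_ofReal_iff hβ.le] at h3
      refine Real.le_sqrt_of_sq_le (le_trans ?_ h3)
      have h4 := Finset.single_le_sum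
        (f := fun i => ‖((zakMatrix g lam z).mulVec (Pi.single j₀ 1)) i‖ ^ 2)
        (fun _ _ => by positivity) (Finset.mem_univ j₀)
      refine le_trans (le_of_eq ?_) h4
      simp [zakMatrix, j₀, Matrix.col, Prod.mk_zero_zero]
    have h2 := (measurePreserving_add_right (volume : Measure (ℝ × ℝ))
      (lam j₀ 1, lam j₀ 0)).quasiMeasurePreserving.ae h1
    filter_upwards [h2] with z hz
    simpa [gaborZak, norm_unitExp] using hz
  have hZ : IsBddVMO (zak g) := .of_isVMOLoc hV (measurable_zak g) hbdd
  have hD : IsBddVMO fun z => (zakMatrix g lam z).det :=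
    .det fun i j => (isBddVMO_gaborZak hZ (lam j)).translate _
  -- the lower bound holds for a countable dense set of vectors at once, hence for all vectors
  have hlow : ∀ᵐ z, ∀ v : Fin N × Fin N → ℂ,
      α * ∑ j, ‖v j‖ ^ 2 ≤ ∑ i, ‖((zakMatrix g lam z).mulVec v) i‖ ^ 2 := by
    have h1 := ae_all_iff.2 fun n : ℕ =>
      hb (TopologicalSpace.denseSeq (Fin N × Fin N → ℂ) n)
    filter_upwards [h1] with z hz
    have hcl : IsClosed {v : Fin N × Fin N → ℂ |
        α * ∑ j, ‖v j‖ ^ 2 ≤ ∑ i, ‖((zakMatrix g lam z).mulVec v) i‖ ^ 2} := by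
      refine isClosed_le (by fun_prop) ?_
      simp only [Matrix.mulVec, dotProduct]
      fun_prop
    intro v
    have hsub : range (TopologicalSpace.denseSeq (Fin N × Fin N → ℂ)) ⊆
        {v : Fin N × Fin N → ℂ |
          α * ∑ j, ‖v j‖ ^ 2 ≤ ∑ i, ‖((zakMatrix g lam z).mulVec v) i‖ ^ 2} := by
      rintro _ ⟨n, rfl⟩
      exact (ENNReal.ofReal_le_ofReal_iff (Finset.sum_nonneg fun _ _ => by positivity)).1 (hz n).1
    exact closure_minimal hsub hcl (TopologicalSpace.denseRange_denseSeq _ v)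
  obtain ⟨c, hc, hdet⟩ : ∃ c > 0, ∀ᵐ z, c ≤ ‖(zakMatrix g lam z).det‖ := by
    refine ⟨_, ?_, hlow.mono fun z hz => le_norm_det_of_bounded_below hα _ hz⟩
    positivity
  have hn := hD.eq_zero_of_quasiperiodic hc hdet ((N * N : ℕ) : ℤ) _
    (det_zakMatrix_add_one_fst g lam) (det_zakMatrix_add_one_snd g lam)
  have hNN : N * N = 0 := by exact_mod_cast hn
  exact hN.ne' (by simpa using hNN)
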